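/- Let $(M^n,g)$ be a compact smooth Riemannian manifold without boundary (not assumed orientable or connected), let $k\ge 0$, and let $[\alpha^*]\in H^k(M)$ be the de Rham cohomology class of a smooth closed $k$-form $\alpha^*$. Let $[\alpha^*]_{C^\infty}$ be the set of smooth closed $k$-forms $\alpha$ with $\alpha-\alpha^*=d\psi$ for some smooth $(k-1)$-form $\psi$, and let $[\alpha^*]_{W^{1,2}}$ be the set of $W^{1,2}$ $k$-forms $\beta$ (identified when equal almost everywhere) with $\beta-\alpha^*=d\psi$ weakly for some $W^{1,2}$ $(k-1)$-form $\psi$; for $k=0$ the only exact form is $0$. For a smooth $k$-form $\alpha$ put $$E_{GMS}(\alpha)=\int_M\sqrt{1+|\alpha|^2}\,dV_g ,$$ where $|\cdot|$ is the pointwise norm of $k$-forms induced by $g$, and for $\beta\in[\alpha^*]_{W^{1,2}}$ put $$E_{GMS}(\beta)=\inf\Big\{\liminf_{m\to\infty}E_{GMS}(\alpha_m)\;:\;\alpha_m\in[\alpha^*]_{C^\infty},\ \alpha_m\to\beta \text{ in } W^{1,2}\Big\}.$$ Let $\alpha\in[\alpha^*]_{C^\infty}$. Then $\alpha$ minimizes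 $E_{GMS}$ over $[\alpha^*]_{C^\infty}$ if and only if $$d^*\!\left(\frac{\alpha}{\sqrt{1+|\alpha|^2}}\right)=0\quad\text{on } M,$$ where $d^*$ is the codifferential of $g$ (with $d^*=0$ on functions). Moreover, if $\alpha$ minimizes $E_{GMS}$ over $[\alpha^*]_{C^\infty}$, then $\alpha$ is the unique minimizer of the extended energy over $[\alpha^*]_{W^{1,2}}$: it minimizes $E_{GMS}$ over $[\alpha^*]_{W^{1,2}}$, and every minimizer $\beta$ of $E_{GMS}$ over $[\alpha^*]_{W^{1,2}}$ equals $\alpha$ almost everywhere. -/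

import Mathlib

open Set Filter MeasureTheory
open scoped Manifold ContDiff Topology ENNReal

noncomputable section

namespace GMS

/-- The model space `ℝⁿ`. -/
abbrev Model (n : ℕ) : Type := EuclideanSpace ℝ (Fin n)

/-- The standard basis vector `e_i` of `ℝⁿ`. -/
def stdVec {n : ℕ} (i : Fin n) : Model n := EuclideanSpace.single i (1 : ℝ)

section Fields

variable {n : ℕ} {M : Type*} [TopologicalSpace M] [ChartedSpace (Model n) M]

/-- (Not necessarily continuous) differential `k`-forms on `M`: fields of alternating `k`-linear
forms on the tangent spaces. -/
abbrev DiffForm (n k : ℕ) (M : Type*) [TopologicalSpace M] [ChartedSpace (Model n) M] : Type _ :=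
  (p : M) → TangentSpace (𝓡 n) p [⋀^Fin k]→L[ℝ] ℝ

/-- A smooth Riemannian metric on `M`. -/
abbrev RMetric (n : ℕ) (M : Type*) [TopologicalSpace M] [ChartedSpace (Model n) M]
    [IsManifold (𝓡 n) ∞ M] : Type _ :=
  Bundle.ContMDiffRiemannianMetric (𝓡 n) ∞ (Model n) (fun p : M => TangentSpace (𝓡 n) p)

/-- The preferred chart at `x`. -/
abbrev chart (n : ℕ) {M : Type*} [TopologicalSpace M] [ChartedSpace (Model n) M] (x : M) :
    OpenPartialHomeomorph M (Model n) :=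
  chartAt (Model n) x

/-- The differential at `y` of the inverse of the chart at `x`; it sends `e_i` to the
coordinate vector field `∂_i`. -/
def dChartSymm (x : M) (y : Model n) :
    Model n →L[ℝ] TangentSpace (𝓡 n) ((chart n x).symm y) :=
  mfderiv (𝓡 n) (𝓡 n) (chart n x).symm y

/-- The differential of the chart at `x`, taken at the point `p`. -/
def dChart (x p : M) : TangentSpace (𝓡 n) p →L[ℝ] Model n :=
  mfderiv (𝓡 n) (𝓡 n) (chart n x) p

/-- The coordinate expression of a form in the chart at `x`: its pullback under the inverse of the
chart.  It is meaningful on the target of the chart. -/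
def rep {k : ℕ} (x : M) (θ : DiffForm n k M) (y : Model n) : Model n [⋀^Fin k]→L[ℝ] ℝ :=
  (θ ((chart n x).symm y)).compContinuousLinearMap (dChartSymm x y)

/-- A form is smooth if its coefficients in every chart are smooth. -/
def IsSmooth {k : ℕ} (θ : DiffForm n k M) : Prop :=
  ∀ x : M, ContDiffOn ℝ ∞ (rep x θ) (chart n x).target

/-- The exterior derivative, computed at `p` in the chart at `p`. -/
def extD {k : ℕ} (θ : DiffForm n k M) : DiffForm n (k + 1) M := fun p =>
  (extDeriv (rep p θ) (chart n p p)).compContinuousLinearMap (dChart p p)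

/-- Closed forms: `dθ = 0`. -/
def IsClosedForm {k : ℕ} (θ : DiffForm n k M) : Prop := ∀ p, extD θ p = 0

/-- Exact forms: `θ = dψ` with `ψ` smooth.  There are no forms of degree `-1`, so an exact `0`-form
is zero. -/
def IsExactForm : {k : ℕ} → DiffForm n k M → Prop
  | 0, θ => ∀ p, θ p = 0
  | k + 1, θ => ∃ ψ : DiffForm n k M, IsSmooth ψ ∧ ∀ p, θ p = extD ψ p

/-- The smooth forms in the de Rham cohomology class of the (closed) form `a`. -/
def smoothClass {k : ℕ} (a : DiffForm n k M) : Set (DiffForm n k M) :=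
  {θ | IsSmooth θ ∧ IsClosedForm θ ∧ IsExactForm (θ - a)}

end Fields

section Metric

variable {n : ℕ} {M : Type*} [TopologicalSpace M] [ChartedSpace (Model n) M]
  [IsManifold (𝓡 n) ∞ M]

/-- The matrix `g_ij` of the metric in the chart at `x`, as a function of the coordinates. -/
def gram (g : RMetric n M) (x : M) (y : Model n) : Matrix (Fin n) (Fin n) ℝ :=
  Matrix.of fun i j =>
    g.inner ((chart n x).symm y) (dChartSymm x y (stdVec i)) (dChartSymm x y (stdVec j))

/-- The inner product of two alternating forms on `ℝⁿ` for the metric with matrix `G`: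
`(1/k!) ∑ G^{i₁j₁} ⋯ G^{i_kj_k} θ_{i₁…i_k} η_{j₁…j_k}`. In a `G`-orthonormal frame this is
`∑_{i₁<…<i_k} θ_{i₁…i_k} η_{i₁…i_k}`. -/
def innerAlt {k : ℕ} (G : Matrix (Fin n) (Fin n) ℝ) (θ η : Model n [⋀^Fin k]→L[ℝ] ℝ) : ℝ :=
  (k.factorial : ℝ)⁻¹ * ∑ I : Fin k → Fin n, ∑ J : Fin k → Fin n,
    (∏ a, G⁻¹ (I a) (J a)) * θ (fun a => stdVec (I a)) * η (fun a => stdVec (J a))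

/-- The pointwise inner product `(θ, η)` of two forms with respect to `g`, computed at `p` in the
chart at `p`. -/
def formInner {k : ℕ} (g : RMetric n M) (θ η : DiffForm n k M) (p : M) : ℝ :=
  innerAlt (gram g p (chart n p p)) (rep p θ (chart n p p)) (rep p η (chart n p p))

/-- `√det g` in the chart at `x`. -/
def sqrtDet (g : RMetric n M) (x : M) (y : Model n) : ℝ := √(gram g x y).det

/-- The codifferential `d^*`. In the chart at `x`, with all indices raised, it is
`(d^*θ)^{i₁…i_k} = -(1/√det g) ∑_i ∂_i (√det g · θ^{i i₁…i_k})`; `codiffRep` is this expression with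
the indices lowered again. Raising (lowering) indices is composition with the matrix `g^{ij}`
(`g_ij`). -/
def codiffRep {k : ℕ} (g : RMetric n M) (x : M) (θ : DiffForm n (k + 1) M) (y : Model n) :
    Model n [⋀^Fin k]→L[ℝ] ℝ :=
  (-(sqrtDet g x y)⁻¹ • ∑ i : Fin n,
    (fderiv ℝ (fun z => sqrtDet g x z • (rep x θ z).compContinuousLinearMap
      (Matrix.toEuclideanCLM (n := Fin n) (𝕜 := ℝ) (gram g x z)⁻¹)) y (stdVec i)).curryLeft
        (stdVec i)).compContinuousLinearMap
    (Matrix.toEuclideanCLM (n := Fin n) (𝕜 := ℝ) (gram g x y))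

/-- The codifferential `d^*` of a `k`-form, computed at `p` in the chart at `p`; it is zero on
functions. -/
def codiff (g : RMetric n M) : {k : ℕ} → DiffForm n k M → DiffForm n (k - 1) M
  | 0, _ => fun _ => 0
  | _ + 1, θ => fun p => (codiffRep g p θ (chart n p p)).compContinuousLinearMap (dChart p p)

variable [MeasurableSpace M]

/-- The Riemannian volume of the domain of the chart at `x`: the measure `√det g dy` on the target
of the chart, transported to `M`. -/
def chartVolume (g : RMetric n M) (x : M) : Measure M :=
  ((volume.restrict (chart n x).target).withDensity
    (fun y => ENNReal.ofReal (sqrtDet g x y))).map (chart n x).symm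

/-- The Riemannian volume measure `dV_g`. The measures `chartVolume g x` agree on the overlaps of
the chart domains, and their supremum is the measure that restricts to each of them. -/
def riemVolume (g : RMetric n M) : Measure M := ⨆ x : M, chartVolume g x

/-- The energy `∫_M √(1 + |θ|²) dV_g`. -/
def energy {k : ℕ} (g : RMetric n M) (θ : DiffForm n k M) : ℝ :=
  ∫ p, √(1 + formInner g θ θ p) ∂(riemVolume g)

/-- The form `θ / √(1 + |θ|²)`. -/
def gmsField {k : ℕ} (g : RMetric n M) (θ : DiffForm n k M) : DiffForm n k M := fun p =>
  (√(1 + formInner g θ θ p))⁻¹ • θ p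

/-- `θ` minimizes the energy among the smooth forms of the class of `a`. -/
def IsSmoothMinimizer {k : ℕ} (g : RMetric n M) (a θ : DiffForm n k M) : Prop :=
  θ ∈ smoothClass a ∧ ∀ η ∈ smoothClass a, energy g θ ≤ energy g η

end Metric

section Sobolev

/-- `D` is the weak derivative of the function `u` on the open set `Ω ⊆ ℝⁿ`. -/
structure HasWeakDerivOn {n : ℕ} {F : Type*} [NormedAddCommGroup F] [NormedSpace ℝ F]
    (Ω : Set (Model n)) (u : Model n → F) (D : Model n → Model n →L[ℝ] F) : Prop where
  locInt : LocallyIntegrableOn u Ω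
  locInt_deriv : LocallyIntegrableOn D Ω
  integral_eq : ∀ φ : Model n → ℝ, ContDiff ℝ ∞ φ → HasCompactSupport φ → tsupport φ ⊆ Ω →
    ∀ v : Model n, ∫ y in Ω, fderiv ℝ φ y v • u y = -∫ y in Ω, φ y • D y v

variable {n : ℕ} {M : Type*} [TopologicalSpace M] [ChartedSpace (Model n) M]

/-- `W^{1,2}` forms on a compact manifold: the coefficients in every chart, together with their weak
first derivatives, are square integrable on compact subsets of the target of the chart. -/
def IsW12 {k : ℕ} (θ : DiffForm n k M) : Prop :=
  ∀ x : M, ∃ D : Model n → Model n →L[ℝ] (Model n [⋀^Fin k]→L[ℝ] ℝ),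
    HasWeakDerivOn (chart n x).target (rep x θ) D ∧
    ∀ K ⊆ (chart n x).target, IsCompact K →
      MemLp (rep x θ) 2 (volume.restrict K) ∧ MemLp D 2 (volume.restrict K)

/-- Convergence in `W^{1,2}` of a sequence of smooth forms `s m` to a `W^{1,2}` form `θ`: in every
chart the coefficients and their first derivatives converge in `L²` on compact subsets of the target
of the chart. -/
def TendstoW12 {k : ℕ} (s : ℕ → DiffForm n k M) (θ : DiffForm n k M) : Prop :=
  ∀ x : M, ∃ D : Model n → Model n →L[ℝ] (Model n [⋀^Fin k]→L[ℝ] ℝ),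
    HasWeakDerivOn (chart n x).target (rep x θ) D ∧
    ∀ K ⊆ (chart n x).target, IsCompact K →
      Tendsto (fun m => eLpNorm (fun y => rep x (s m) y - rep x θ y) 2 (volume.restrict K))
        atTop (𝓝 0) ∧
      Tendsto (fun m => eLpNorm (fun y => fderiv ℝ (rep x (s m)) y - D y) 2 (volume.restrict K))
        atTop (𝓝 0)

/-- `θ = dψ` weakly, for some `W^{1,2}` form `ψ`: in every chart `θ` agrees almost everywhere with
the alternation of the weak derivative of `ψ`. As for smooth forms, an exact `0`-form is zero. -/
def IsWeaklyExact : {k : ℕ} → DiffForm n k M → Prop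
  | 0, θ => ∀ x : M, ∀ᵐ y ∂(volume.restrict (chart n x).target), rep x θ y = 0
  | k + 1, θ => ∃ ψ : DiffForm n k M, IsW12 ψ ∧
      ∀ x : M, ∃ D : Model n → Model n →L[ℝ] (Model n [⋀^Fin k]→L[ℝ] ℝ),
        HasWeakDerivOn (chart n x).target (rep x ψ) D ∧
        ∀ᵐ y ∂(volume.restrict (chart n x).target),
          rep x θ y = ContinuousAlternatingMap.alternatizeUncurryFin (D y)

/-- The `W^{1,2}` forms in the cohomology class of the smooth closed form `a`. -/
def w12Class {k : ℕ} (a : DiffForm n k M) : Set (DiffForm n k M) :=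
  {θ | IsW12 θ ∧ IsWeaklyExact (θ - a)}

variable [IsManifold (𝓡 n) ∞ M] [MeasurableSpace M]

/-- The energy extended to the `W^{1,2}` forms in the class of `a`: the infimum of
`liminf energy (s m)` over the sequences `s` of smooth forms of the class that converge to `θ` in
`W^{1,2}`. -/
def relaxedEnergy {k : ℕ} (g : RMetric n M) (a θ : DiffForm n k M) : EReal :=
  ⨅ s : {s : ℕ → DiffForm n k M // (∀ m, s m ∈ smoothClass a) ∧ TendstoW12 s θ},
    liminf (fun m => ((energy g (s.1 m) : ℝ) : EReal)) atTop

/-- `θ` minimizes the (extended) energy among the `W^{1,2}` forms of the class of `a`. -/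
def IsW12Minimizer {k : ℕ} (g : RMetric n M) (a θ : DiffForm n k M) : Prop :=
  θ ∈ w12Class a ∧ ∀ η ∈ w12Class a, relaxedEnergy g a θ ≤ relaxedEnergy g a η

end Sobolev

end GMS

end

/-!
The energy density `√(1 + |α|²)` is a strictly convex function of `α`, so that the equivalence of
minimality and the Euler–Lagrange equation and the uniqueness both come from the convexity defect
`√(1 + |η|²) - √(1 + |θ|²) - (θ / √(1 + |θ|²), η - θ)` (`convexityDefect`, `formDefect`). It is
nonnegative by the Cauchy–Schwarz inequality, and it vanishes only if `η = θ`
(`eq_of_convexityDefect_eq_zero`).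

Green's formula (`integral_formInner_extD`) is the divergence theorem in a chart; with a partition
of unity it shows that a smooth form is coclosed if and only if it is `L²`-orthogonal to all exact
forms (`codiff_eq_zero_iff`). The codifferential is defined at each point in the chart preferred at
this point, and Green's formula needs its vanishing in a fixed chart. Instead of transforming second
derivatives of the coordinate changes, `codiffRep_eq_zero_of_codiff` gets this from Green's formula
itself: the exterior derivative, the inner product and the volume do not depend on the chart, hence
neither does the weakly determined codifferential.

If `α` minimizes, then `α / √(1 + |α|²)` is orthogonal to the exact forms, because
`√(1 + |α + t w|²)` lies below an explicit quadratic polynomial in `t`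
(`sqrt_innerAlt_add_smul_le`). Conversely, under this orthogonality the excess of energy of a
competitor `η` is the integral of the convexity defect of `α` and `η`, which is nonnegative
(`isSmoothMinimizer_iff`).

The relaxed energy is at least the infimum of the energy on the smooth class, and at most the energy
on smooth forms, so a smooth minimizer minimizes it. If `β` is another minimizer, there are smooth
forms of the class that converge to `β` in `W^{1,2}` and whose energies exceed the minimum by
arbitrarily little. Their convexity defects relative to `α` have small integrals, and a subsequence
converges almost everywhere, so Fatou's lemma makes the convexity defect of `α` and `β` vanish
almost everywhere (`ae_eq_of_isW12Minimizer`).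
-/

namespace GMS

/-! ### Inner products of alternating forms and convexity of the energy density -/

section LinearAlgebra

variable {n k : ℕ}

theorem toEuclideanCLM_stdVec (A : Matrix (Fin n) (Fin n) ℝ) (j : Fin n) :
    Matrix.toEuclideanCLM (n := Fin n) (𝕜 := ℝ) A (stdVec j) = ∑ i, A i j • stdVec i := by
  ext i
  simp [stdVec, Matrix.ofLp_toEuclideanCLM, Matrix.mulVec, dotProduct, Pi.single_apply]

/-- Multilinear expansion of `θ (A e_{I₁}, …, A e_{I_k})`. -/
theorem map_toEuclideanCLM_stdVec (θ : Model n [⋀^Fin k]→L[ℝ] ℝ) (A : Matrix (Fin n) (Fin n) ℝ)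
    (I : Fin k → Fin n) :
    θ (fun a => Matrix.toEuclideanCLM (n := Fin n) (𝕜 := ℝ) A (stdVec (I a))) =
      ∑ K : Fin k → Fin n, (∏ a, A (K a) (I a)) * θ (fun a => stdVec (K a)) := by
  simp_rw [toEuclideanCLM_stdVec]
  have h := θ.toMultilinearMap.map_sum (fun (a : Fin k) (i : Fin n) => A i (I a) • stdVec i)
  refine h.trans (Finset.sum_congr rfl fun K _ => ?_)
  have h2 := θ.toMultilinearMap.map_smul_univ (fun a => A (K a) (I a)) (fun a => stdVec (K a))
  simpa using h2

theorem ext_stdVec {θ η : Model n [⋀^Fin k]→L[ℝ] ℝ}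
    (h : ∀ I : Fin k → Fin n, θ (fun a => stdVec (I a)) = η (fun a => stdVec (I a))) : θ = η := by
  apply ContinuousAlternatingMap.toAlternatingMap_injective
  refine Module.Basis.ext_alternating (EuclideanSpace.basisFun (Fin n) ℝ).toBasis fun v _ => ?_
  simpa [stdVec] using h v

theorem sum_sum_mul_sum_mul_sum {ι : Type*} [Fintype ι] (P b : ι → ι → ℝ) (t e : ι → ℝ) :
    ∑ I, ∑ J, P I J * (∑ K, b K I * t K) * (∑ L, b L J * e L) =
      ∑ K, ∑ L, (∑ I, ∑ J, P I J * b K I * b L J) * t K * e L := by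
  simp only [Finset.mul_sum, Finset.sum_mul]
  calc _ = ∑ I, ∑ J, ∑ K, ∑ L, P I J * (b K I * t K) * (b L J * e L) :=
        Finset.sum_congr rfl fun I _ => Finset.sum_congr rfl fun J _ => Finset.sum_comm
    _ = ∑ I, ∑ K, ∑ J, ∑ L, P I J * (b K I * t K) * (b L J * e L) :=
        Finset.sum_congr rfl fun I _ => Finset.sum_comm
    _ = ∑ K, ∑ I, ∑ J, ∑ L, P I J * (b K I * t K) * (b L J * e L) := Finset.sum_comm
    _ = ∑ K, ∑ I, ∑ L, ∑ J, P I J * (b K I * t K) * (b L J * e L) :=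
        Finset.sum_congr rfl fun K _ => Finset.sum_congr rfl fun I _ => Finset.sum_comm
    _ = ∑ K, ∑ L, ∑ I, ∑ J, P I J * (b K I * t K) * (b L J * e L) :=
        Finset.sum_congr rfl fun K _ => Finset.sum_comm
    _ = _ := Finset.sum_congr rfl fun K _ => Finset.sum_congr rfl fun L _ =>
        Finset.sum_congr rfl fun I _ => Finset.sum_congr rfl fun J _ => by ring

theorem sum_prod_mul_map_toEuclideanCLM (H A : Matrix (Fin n) (Fin n) ℝ)
    (θ η : Model n [⋀^Fin k]→L[ℝ] ℝ) :
    ∑ I : Fin k → Fin n, ∑ J : Fin k → Fin n, (∏ a, H (I a) (J a)) *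
      θ (fun a => Matrix.toEuclideanCLM (n := Fin n) (𝕜 := ℝ) A (stdVec (I a))) *
      η (fun a => Matrix.toEuclideanCLM (n := Fin n) (𝕜 := ℝ) A (stdVec (J a))) =
    ∑ K : Fin k → Fin n, ∑ L : Fin k → Fin n, (∏ a, (A * H * A.transpose) (K a) (L a)) *
      θ (fun a => stdVec (K a)) * η (fun a => stdVec (L a)) := by
  have key : ∀ K L : Fin k → Fin n, ∏ a, (A * H * A.transpose) (K a) (L a) =
      ∑ I : Fin k → Fin n, ∑ J : Fin k → Fin n,
        (∏ a, H (I a) (J a)) * (∏ a, A (K a) (I a)) * (∏ a, A (L a) (J a)) := by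
    intro K L
    have h1 : ∀ a, (A * H * A.transpose) (K a) (L a) =
        ∑ j, ∑ i, H i j * A (K a) i * A (L a) j := by
      intro a
      simp only [Matrix.mul_apply, Matrix.transpose_apply, Finset.sum_mul]
      refine Finset.sum_congr rfl fun j _ => Finset.sum_congr rfl fun i _ => by ring
    simp_rw [h1]
    rw [Finset.prod_univ_sum]
    simp only [Fintype.piFinset_univ]
    rw [Finset.sum_comm (s := (Finset.univ : Finset (Fin k → Fin n)))]
    refine Finset.sum_congr rfl fun J _ => ?_
    rw [Finset.prod_univ_sum]
    simp only [Fintype.piFinset_univ]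
    refine Finset.sum_congr rfl fun I _ => ?_
    rw [Finset.prod_mul_distrib, Finset.prod_mul_distrib]
  have h := sum_sum_mul_sum_mul_sum (fun I J : Fin k → Fin n => ∏ a, H (I a) (J a))
    (fun K I => ∏ a, A (K a) (I a)) (fun K => θ fun a => stdVec (K a))
    (fun L => η fun a => stdVec (L a))
  simp only [← key, ← map_toEuclideanCLM_stdVec] at h
  exact h

/-- A linear change of coordinates `A` turns the matrix `G` of a metric into `Aᵀ G A` and a form
`θ` into `θ ∘ A`; the inner product of forms does not see it. -/
theorem innerAlt_comp {G A : Matrix (Fin n) (Fin n) ℝ} (hA : IsUnit A.det)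
    (θ η : Model n [⋀^Fin k]→L[ℝ] ℝ) :
    innerAlt (A.transpose * G * A)
      (θ.compContinuousLinearMap (Matrix.toEuclideanCLM (n := Fin n) (𝕜 := ℝ) A))
      (η.compContinuousLinearMap (Matrix.toEuclideanCLM (n := Fin n) (𝕜 := ℝ) A)) =
    innerAlt G θ η := by
  have hAt : IsUnit A.transpose.det := by rwa [Matrix.det_transpose]
  have h : A * (A.transpose * G * A)⁻¹ * A.transpose = G⁻¹ := by
    rw [Matrix.mul_inv_rev, Matrix.mul_inv_rev, ← Matrix.mul_assoc, ← Matrix.mul_assoc,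
      Matrix.mul_nonsing_inv _ hA, Matrix.one_mul, Matrix.mul_assoc,
      Matrix.nonsing_inv_mul _ hAt, Matrix.mul_one]
  unfold innerAlt
  congr 1
  rw [← h]
  exact sum_prod_mul_map_toEuclideanCLM _ A θ η

/-- The inner product of `θ` and `η` is the contraction of `η` with the form `θ` whose indices have
been raised. -/
theorem innerAlt_eq_sum (G : Matrix (Fin n) (Fin n) ℝ) (θ η : Model n [⋀^Fin k]→L[ℝ] ℝ) :
    innerAlt G θ η = (k.factorial : ℝ)⁻¹ * ∑ J : Fin k → Fin n,
      (θ.compContinuousLinearMap (Matrix.toEuclideanCLM (n := Fin n) (𝕜 := ℝ) G⁻¹))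
        (fun a => stdVec (J a)) * η (fun a => stdVec (J a)) := by
  unfold innerAlt
  congr 1
  rw [Finset.sum_comm]
  refine Finset.sum_congr rfl fun J _ => ?_
  rw [← Finset.sum_mul]
  congr 1
  exact (map_toEuclideanCLM_stdVec θ G⁻¹ J).symm

/-- Raising the indices undoes lowering them. -/
theorem innerAlt_lower {G : Matrix (Fin n) (Fin n) ℝ} (hG : IsUnit G.det)
    (ξ η : Model n [⋀^Fin k]→L[ℝ] ℝ) :
    innerAlt G (ξ.compContinuousLinearMap (Matrix.toEuclideanCLM (n := Fin n) (𝕜 := ℝ) G)) η =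
      (k.factorial : ℝ)⁻¹ * ∑ J : Fin k → Fin n,
        ξ (fun a => stdVec (J a)) * η (fun a => stdVec (J a)) := by
  rw [innerAlt_eq_sum]
  have h : (ξ.compContinuousLinearMap (Matrix.toEuclideanCLM (n := Fin n) (𝕜 := ℝ) G)
      ).compContinuousLinearMap (Matrix.toEuclideanCLM (n := Fin n) (𝕜 := ℝ) G⁻¹) = ξ := by
    ext v
    simp only [ContinuousAlternatingMap.compContinuousLinearMap_apply]
    congr 1
    ext1 a
    have := congrArg (fun T => T (v a))
      (map_mul (Matrix.toEuclideanCLM (n := Fin n) (𝕜 := ℝ)) G G⁻¹)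
    rw [Matrix.mul_nonsing_inv _ hG, map_one] at this
    exact this.symm
  rw [h]

/-- The contraction of a `(k+1)`-form with an alternatized derivative only sees the derivative in
the first slot, each of the `k+1` slots contributing the same. -/
theorem sum_mul_alternatizeUncurryFin (ξ : Model n [⋀^Fin (k + 1)]→L[ℝ] ℝ)
    (f : Model n →L[ℝ] (Model n [⋀^Fin k]→L[ℝ] ℝ)) :
    ((k + 1).factorial : ℝ)⁻¹ * ∑ J : Fin (k + 1) → Fin n, ξ (fun a => stdVec (J a)) *
        ContinuousAlternatingMap.alternatizeUncurryFin f (fun a => stdVec (J a)) =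
      (k.factorial : ℝ)⁻¹ * ∑ i : Fin n, ∑ J : Fin k → Fin n,
        ξ.curryLeft (stdVec i) (fun a => stdVec (J a)) *
          f (stdVec i) (fun a => stdVec (J a)) := by
  have slot : ∀ p : Fin (k + 1), ∑ J : Fin (k + 1) → Fin n, ξ (fun a => stdVec (J a)) *
      ((-1) ^ (p : ℕ) • f (stdVec (J p)) (p.removeNth fun a => stdVec (J a))) =
      ∑ i : Fin n, ∑ J : Fin k → Fin n,
        ξ.curryLeft (stdVec i) (fun a => stdVec (J a)) *
          f (stdVec i) (fun a => stdVec (J a)) := by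
    intro p
    rw [← (Fin.insertNthEquiv (fun _ => Fin n) p).sum_comp, Fintype.sum_prod_type]
    refine Finset.sum_congr rfl fun i _ => Finset.sum_congr rfl fun J _ => ?_
    have h1 : (fun a => stdVec (Fin.insertNthEquiv (fun _ => Fin n) p (i, J) a)) =
        (p.insertNth (stdVec i) (fun a => stdVec (J a)) : Fin (k + 1) → Model n) := by
      rw [Fin.eq_insertNth_iff]
      refine ⟨by simp, ?_⟩
      ext1 a
      simp [Fin.removeNth]
    have h2 := ξ.map_insertNth p (stdVec i) (fun a => stdVec (J a))
    have h3 : ((-1 : ℝ) ^ (p : ℕ)) * (-1) ^ (p : ℕ) = 1 := by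
      rw [← mul_pow]; simp
    rw [h1, Fin.removeNth_insertNth, h2]
    simp only [Fin.insertNthEquiv_apply, Fin.insertNth_apply_same,
      ContinuousAlternatingMap.curryLeft_apply_apply, zsmul_eq_mul]
    push_cast
    linear_combination
      (ξ (Matrix.vecCons (stdVec i) fun a => stdVec (J a)) *
        f (stdVec i) fun a => stdVec (J a)) * h3
  have hk : ((k + 1).factorial : ℝ) = (k + 1) * k.factorial := by
    rw [Nat.factorial_succ]; push_cast; ring
  have hs : ∀ J : Fin (k + 1) → Fin n, ξ (fun a => stdVec (J a)) *
      ContinuousAlternatingMap.alternatizeUncurryFin f (fun a => stdVec (J a)) =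
      ∑ p : Fin (k + 1), ξ (fun a => stdVec (J a)) *
        ((-1) ^ (p : ℕ) • f (stdVec (J p)) (p.removeNth fun a => stdVec (J a))) := fun J => by
    rw [ContinuousAlternatingMap.alternatizeUncurryFin_apply, Finset.mul_sum]
  rw [Finset.sum_congr rfl fun J _ => hs J, Finset.sum_comm, Finset.sum_congr rfl fun p _ => slot p]
  rw [Finset.sum_const, Finset.card_univ, Fintype.card_fin, hk, nsmul_eq_mul]
  have : (k.factorial : ℝ) ≠ 0 := by positivity
  push_cast
  field_simp

theorem innerAlt_add_left (G : Matrix (Fin n) (Fin n) ℝ) (θ θ' η : Model n [⋀^Fin k]→L[ℝ] ℝ) :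
    innerAlt G (θ + θ') η = innerAlt G θ η + innerAlt G θ' η := by
  simp only [innerAlt, ContinuousAlternatingMap.add_apply, mul_add, add_mul,
    Finset.sum_add_distrib]

theorem innerAlt_add_right (G : Matrix (Fin n) (Fin n) ℝ) (θ η η' : Model n [⋀^Fin k]→L[ℝ] ℝ) :
    innerAlt G θ (η + η') = innerAlt G θ η + innerAlt G θ η' := by
  simp only [innerAlt, ContinuousAlternatingMap.add_apply, mul_add, Finset.sum_add_distrib]

theorem innerAlt_smul_left (G : Matrix (Fin n) (Fin n) ℝ) (c : ℝ)
    (θ η : Model n [⋀^Fin k]→L[ℝ] ℝ) : innerAlt G (c • θ) η = c * innerAlt G θ η := by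
  simp only [innerAlt, ContinuousAlternatingMap.smul_apply, Finset.mul_sum, smul_eq_mul]
  refine Finset.sum_congr rfl fun J _ => Finset.sum_congr rfl fun J _ => by ring

theorem innerAlt_smul_right (G : Matrix (Fin n) (Fin n) ℝ) (c : ℝ)
    (θ η : Model n [⋀^Fin k]→L[ℝ] ℝ) : innerAlt G θ (c • η) = c * innerAlt G θ η := by
  simp only [innerAlt, ContinuousAlternatingMap.smul_apply, Finset.mul_sum, smul_eq_mul]
  refine Finset.sum_congr rfl fun J _ => Finset.sum_congr rfl fun J _ => by ring

theorem innerAlt_zero_left (G : Matrix (Fin n) (Fin n) ℝ) (η : Model n [⋀^Fin k]→L[ℝ] ℝ) :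
    innerAlt G 0 η = 0 := by
  simpa using innerAlt_smul_left G 0 0 η

theorem innerAlt_zero_right (G : Matrix (Fin n) (Fin n) ℝ) (η : Model n [⋀^Fin k]→L[ℝ] ℝ) :
    innerAlt G η 0 = 0 := by
  simpa using innerAlt_smul_right G 0 η 0

open scoped MatrixOrder in
/-- In a frame that is orthonormal for `G` the inner product of forms is, up to the factor `k!`, the
Euclidean inner product of the families of coefficients. -/
theorem exists_innerAlt_eq_sum {G : Matrix (Fin n) (Fin n) ℝ} (hG : G.PosDef) (k : ℕ) :
    ∃ T : (Model n [⋀^Fin k]→L[ℝ] ℝ) →ₗ[ℝ] ((Fin k → Fin n) → ℝ), Function.Injective T ∧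
      ∀ θ η, innerAlt G θ η = (k.factorial : ℝ)⁻¹ * ∑ J, T θ J * T η J := by
  obtain ⟨B, hGB⟩ : ∃ B : Matrix (Fin n) (Fin n) ℝ, G = B.transpose * B := by
    obtain ⟨B, hB⟩ := CStarAlgebra.nonneg_iff_eq_star_mul_self.mp hG.posSemidef.nonneg
    exact ⟨B, by
      rw [hB, Matrix.star_eq_conjTranspose, Matrix.conjTranspose_eq_transpose_of_trivial]⟩
  have hB : IsUnit B.det := by
    have := hG.det_pos
    rw [hGB, Matrix.det_mul, Matrix.det_transpose] at this
    exact isUnit_iff_ne_zero.mpr fun h => by simp [h] at this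
  let L : Model n →L[ℝ] Model n := Matrix.toEuclideanCLM (n := Fin n) (𝕜 := ℝ) B⁻¹
  have hL : ∀ θ : Model n [⋀^Fin k]→L[ℝ] ℝ, (θ.compContinuousLinearMap L).compContinuousLinearMap
      (Matrix.toEuclideanCLM (n := Fin n) (𝕜 := ℝ) B) = θ := by
    intro θ
    ext v
    simp only [ContinuousAlternatingMap.compContinuousLinearMap_apply]
    congr 1
    ext1 a
    have := congrArg (fun T => T (v a))
      (map_mul (Matrix.toEuclideanCLM (n := Fin n) (𝕜 := ℝ)) B⁻¹ B)
    rw [Matrix.nonsing_inv_mul _ hB, map_one] at this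
    exact this.symm
  refine ⟨⟨⟨fun θ J => θ.compContinuousLinearMap L fun a => stdVec (J a), fun θ η => by ext J; rfl⟩,
    fun c θ => by ext J; rfl⟩, fun θ η h => ?_, fun θ η => ?_⟩
  · have h' : θ.compContinuousLinearMap L = η.compContinuousLinearMap L :=
      ext_stdVec fun I => congrFun h I
    rw [← hL θ, ← hL η, h']
  · have h1 := innerAlt_comp (G := 1) hB (θ.compContinuousLinearMap L) (η.compContinuousLinearMap L)
    rw [hL, hL, Matrix.mul_one, ← hGB] at h1
    rw [h1, innerAlt_eq_sum]
    congr 1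
    refine Finset.sum_congr rfl fun J _ => ?_
    rw [inv_one, map_one]
    rfl

theorem innerAlt_comm {G : Matrix (Fin n) (Fin n) ℝ} (hG : G.PosDef)
    (θ η : Model n [⋀^Fin k]→L[ℝ] ℝ) : innerAlt G θ η = innerAlt G η θ := by
  obtain ⟨T, -, h⟩ := exists_innerAlt_eq_sum hG k
  simp only [h, mul_comm]

theorem innerAlt_self_nonneg {G : Matrix (Fin n) (Fin n) ℝ} (hG : G.PosDef)
    (θ : Model n [⋀^Fin k]→L[ℝ] ℝ) : 0 ≤ innerAlt G θ θ := by
  obtain ⟨T, -, h⟩ := exists_innerAlt_eq_sum hG k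
  rw [h]
  exact mul_nonneg (by positivity) (Finset.sum_nonneg fun J _ => mul_self_nonneg _)

theorem eq_zero_of_innerAlt_self {G : Matrix (Fin n) (Fin n) ℝ} (hG : G.PosDef)
    {θ : Model n [⋀^Fin k]→L[ℝ] ℝ} (h0 : innerAlt G θ θ = 0) : θ = 0 := by
  obtain ⟨T, hT, h⟩ := exists_innerAlt_eq_sum hG k
  rw [h, mul_eq_zero, or_iff_right (by positivity),
    Finset.sum_eq_zero_iff_of_nonneg fun J _ => mul_self_nonneg _] at h0
  apply hT
  ext J
  simpa using h0 J (Finset.mem_univ J)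

theorem innerAlt_sq_le {G : Matrix (Fin n) (Fin n) ℝ} (hG : G.PosDef)
    (θ η : Model n [⋀^Fin k]→L[ℝ] ℝ) :
    innerAlt G θ η ^ 2 ≤ innerAlt G θ θ * innerAlt G η η := by
  obtain ⟨T, -, h⟩ := exists_innerAlt_eq_sum hG k
  have := Finset.sum_mul_sq_le_sq_mul_sq Finset.univ (T θ) (T η)
  simp only [h, ← sq]
  rw [mul_pow, mul_mul_mul_comm, ← sq]
  gcongr

/-- The defect of convexity of `v ↦ √(1 + |v|²)`: the difference at `v` between this function and
its linearization at `u`. -/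
noncomputable def convexityDefect (G : Matrix (Fin n) (Fin n) ℝ)
    (u v : Model n [⋀^Fin k]→L[ℝ] ℝ) : ℝ :=
  √(1 + innerAlt G v v) - √(1 + innerAlt G u u)
    - (√(1 + innerAlt G u u))⁻¹ * innerAlt G u (v - u)

theorem innerAlt_sub_right (G : Matrix (Fin n) (Fin n) ℝ) (θ η η' : Model n [⋀^Fin k]→L[ℝ] ℝ) :
    innerAlt G θ (η - η') = innerAlt G θ η - innerAlt G θ η' := by
  have := innerAlt_add_right G θ (η - η') η'
  rw [sub_add_cancel] at this
  linarith

/-- This is the Cauchy–Schwarz inequality in the form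
`(1 + ⟨u, v⟩)² + |v - u|² ≤ (1 + |u|²) (1 + |v|²)`. -/
theorem mul_convexityDefect {G : Matrix (Fin n) (Fin n) ℝ} (hG : G.PosDef)
    (u v : Model n [⋀^Fin k]→L[ℝ] ℝ) :
    √(1 + innerAlt G u u) * convexityDefect G u v =
      √(1 + innerAlt G u u) * √(1 + innerAlt G v v) - (1 + innerAlt G u v) ∧
    (1 + innerAlt G u v) ^ 2 + innerAlt G (v - u) (v - u) ≤
      (√(1 + innerAlt G u u) * √(1 + innerAlt G v v)) ^ 2 := by
  have hu := innerAlt_self_nonneg hG u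
  have hv := innerAlt_self_nonneg hG v
  have hs : √(1 + innerAlt G u u) ≠ 0 := by positivity
  have hs2 := Real.sq_sqrt (show 0 ≤ 1 + innerAlt G u u by positivity)
  constructor
  · rw [convexityDefect, innerAlt_sub_right]
    field_simp
    linear_combination -hs2
  · have h1 := innerAlt_sq_le hG u v
    have h2 : innerAlt G (v - u) (v - u) =
        innerAlt G v v - 2 * innerAlt G u v + innerAlt G u u := by
      rw [innerAlt_sub_right, innerAlt_comm hG (v - u) v, innerAlt_comm hG (v - u) u,
        innerAlt_sub_right, innerAlt_sub_right, innerAlt_comm hG v u]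
      ring
    rw [mul_pow, hs2, Real.sq_sqrt (by positivity), h2]
    nlinarith

theorem convexityDefect_nonneg {G : Matrix (Fin n) (Fin n) ℝ} (hG : G.PosDef)
    (u v : Model n [⋀^Fin k]→L[ℝ] ℝ) : 0 ≤ convexityDefect G u v := by
  obtain ⟨h1, h2⟩ := mul_convexityDefect hG u v
  have hu := innerAlt_self_nonneg hG u
  have h3 := innerAlt_self_nonneg hG (v - u)
  have hs : 0 < √(1 + innerAlt G u u) := by positivity
  refine nonneg_of_mul_nonneg_right (?_ : 0 ≤ √(1 + innerAlt G u u) * _) hs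
  rw [h1, sub_nonneg]
  exact le_of_sq_le_sq (by linarith) (by positivity)

theorem eq_of_convexityDefect_eq_zero {G : Matrix (Fin n) (Fin n) ℝ} (hG : G.PosDef)
    {u v : Model n [⋀^Fin k]→L[ℝ] ℝ} (h : convexityDefect G u v = 0) : v = u := by
  obtain ⟨h1, h2⟩ := mul_convexityDefect hG u v
  rw [h, mul_zero, eq_comm, sub_eq_zero] at h1
  rw [h1] at h2
  exact sub_eq_zero.mp <| eq_zero_of_innerAlt_self hG <|
    le_antisymm (by linarith) (innerAlt_self_nonneg hG _)

/-- The tangent line of the concave function `√` bounds the energy density along a line. -/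
theorem sqrt_innerAlt_add_smul_le {G : Matrix (Fin n) (Fin n) ℝ} (hG : G.PosDef)
    (u w : Model n [⋀^Fin k]→L[ℝ] ℝ) (t : ℝ) :
    √(1 + innerAlt G (u + t • w) (u + t • w)) ≤ √(1 + innerAlt G u u) +
      t * ((√(1 + innerAlt G u u))⁻¹ * innerAlt G u w) + t ^ 2 * innerAlt G w w := by
  have hu := innerAlt_self_nonneg hG u
  have hw := innerAlt_self_nonneg hG w
  have huw := innerAlt_self_nonneg hG (u + t • w)
  have h : innerAlt G (u + t • w) (u + t • w) =
      innerAlt G u u + 2 * t * innerAlt G u w + t ^ 2 * innerAlt G w w := by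
    simp only [innerAlt_add_right, innerAlt_add_left, innerAlt_smul_left, innerAlt_smul_right,
      innerAlt_comm hG w u]
    ring
  set s := √(1 + innerAlt G u u)
  have hs1 : 1 ≤ s := Real.one_le_sqrt.mpr (by linarith)
  have hs2 : s ^ 2 = 1 + innerAlt G u u := Real.sq_sqrt (by positivity)
  set r := √(1 + innerAlt G (u + t • w) (u + t • w))
  have hr2 : r ^ 2 = 1 + innerAlt G (u + t • w) (u + t • w) := Real.sq_sqrt (by positivity)
  have h4 : 2 * s * r ≤ s ^ 2 + r ^ 2 := two_mul_le_add_sq s r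
  have h5 : r ≤ s + t * (s⁻¹ * innerAlt G u w) + t ^ 2 * innerAlt G w w * (s⁻¹ / 2) := by
    have : 2 * s * r ≤
        2 * s * (s + t * (s⁻¹ * innerAlt G u w) + t ^ 2 * innerAlt G w w * (s⁻¹ / 2)) := by
      have hs : s ≠ 0 := by positivity
      have e : 2 * s * (s + t * (s⁻¹ * innerAlt G u w) + t ^ 2 * innerAlt G w w * (s⁻¹ / 2)) =
          2 * s ^ 2 + 2 * t * innerAlt G u w + t ^ 2 * innerAlt G w w := by
        field_simp
      rw [e]
      linarith
    exact le_of_mul_le_mul_left this (by positivity)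
  have h6 : s⁻¹ / 2 ≤ 1 := by
    have := inv_le_one_of_one_le₀ hs1
    linarith
  have h7 : t ^ 2 * innerAlt G w w * (s⁻¹ / 2) ≤ t ^ 2 * innerAlt G w w :=
    mul_le_of_le_one_right (by positivity) h6
  linarith

end LinearAlgebra

/-! ### Changes of charts -/

section Charts

theorem bilin_comp_toEuclideanCLM {n : ℕ} (b : Model n →L[ℝ] Model n →L[ℝ] ℝ)
    (D : Model n →L[ℝ] Model n) (A : Matrix (Fin n) (Fin n) ℝ) (i j : Fin n) :
    b ((D.comp (Matrix.toEuclideanCLM (n := Fin n) (𝕜 := ℝ) A)) (stdVec i))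
        ((D.comp (Matrix.toEuclideanCLM (n := Fin n) (𝕜 := ℝ) A)) (stdVec j)) =
      (A.transpose * (Matrix.of fun a c => b (D (stdVec a)) (D (stdVec c))) * A) i j := by
  simp only [ContinuousLinearMap.comp_apply, toEuclideanCLM_stdVec, map_sum, map_smul, sum_apply,
    smul_apply, Matrix.mul_apply, Matrix.transpose_apply, Matrix.of_apply, Finset.sum_mul,
    smul_eq_mul, Finset.mul_sum]
  refine Finset.sum_congr rfl fun a _ => Finset.sum_congr rfl fun c _ => by ring

variable {n : ℕ} {M : Type*} [TopologicalSpace M] [ChartedSpace (Model n) M]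

/-- The change of coordinates from the chart at `x` to the chart at `x'`. -/
def coordChange (n : ℕ) {M : Type*} [TopologicalSpace M] [ChartedSpace (Model n) M] (x x' : M)
    (y : Model n) : Model n :=
  chart n x' ((chart n x).symm y)

/-- The part of the target of the chart at `x` which corresponds to points of the domain of the
chart at `x'`. -/
def overlap (n : ℕ) {M : Type*} [TopologicalSpace M] [ChartedSpace (Model n) M] (x x' : M) :
    Set (Model n) :=
  (chart n x).target ∩ (chart n x).symm ⁻¹' (chart n x').source

theorem isOpen_overlap (x x' : M) : IsOpen (overlap n x x') :=
  (chart n x).isOpen_inter_preimage_symm (chart n x').open_source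

theorem coordChange_mem_overlap {x x' : M} {y : Model n} (hy : y ∈ overlap n x x') :
    coordChange n x x' y ∈ overlap n x' x := by
  refine ⟨(chart n x').map_source hy.2, ?_⟩
  simp only [mem_preimage, coordChange, (chart n x').left_inv hy.2]
  exact (chart n x).map_target hy.1

theorem symm_coordChange {x x' : M} {y : Model n} (hy : y ∈ overlap n x x') :
    (chart n x').symm (coordChange n x x' y) = (chart n x).symm y :=
  (chart n x').left_inv hy.2

theorem coordChange_coordChange {x x' : M} {y : Model n} (hy : y ∈ overlap n x x') :
    coordChange n x' x (coordChange n x x' y) = y := by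
  rw [coordChange, symm_coordChange hy, (chart n x).right_inv hy.1]

theorem mem_overlap_self {x : M} {y : Model n} (hy : y ∈ (chart n x).target) :
    y ∈ overlap n x ((chart n x).symm y) :=
  ⟨hy, mem_chart_source _ _⟩

variable [IsManifold (𝓡 n) ∞ M]

theorem contDiffOn_coordChange (x x' : M) :
    ContDiffOn ℝ ∞ (coordChange n x x') (overlap n x x') := by
  rw [← contMDiffOn_iff_contDiffOn]
  exact (contMDiffOn_chart (I := 𝓡 n) (n := ∞) (x := x')).comp
    ((contMDiffOn_chart_symm (I := 𝓡 n) (n := ∞) (x := x)).mono inter_subset_left)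
    fun y hy => hy.2

theorem contDiffAt_coordChange {x x' : M} {y : Model n} (hy : y ∈ overlap n x x') :
    ContDiffAt ℝ ∞ (coordChange n x x') y :=
  (contDiffOn_coordChange x x').contDiffAt ((isOpen_overlap x x').mem_nhds hy)

theorem fderiv_coordChange_comp {x x' : M} {y : Model n} (hy : y ∈ overlap n x x') :
    (fderiv ℝ (coordChange n x' x) (coordChange n x x' y)).comp
      (fderiv ℝ (coordChange n x x') y) = ContinuousLinearMap.id ℝ (Model n) := by
  have h1 := ((contDiffAt_coordChange (coordChange_mem_overlap hy)).differentiableAt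
    (by simp)).hasFDerivAt.comp y ((contDiffAt_coordChange hy).differentiableAt
    (by simp)).hasFDerivAt
  refine h1.unique ((hasFDerivAt_id y).congr_of_eventuallyEq ?_)
  filter_upwards [(isOpen_overlap x x').mem_nhds hy] with z hz
  exact coordChange_coordChange hz

theorem mdifferentiableAt_chart_symm {x : M} {y : Model n} (hy : y ∈ (chart n x).target) :
    MDifferentiableAt (𝓡 n) (𝓡 n) (chart n x).symm y :=
  ((contMDiffOn_chart_symm (I := 𝓡 n) (n := ∞) (x := x)).contMDiffAt
    ((chart n x).open_target.mem_nhds hy)).mdifferentiableAt (by simp)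

theorem mdifferentiableAt_chart {x p : M} (hp : p ∈ (chart n x).source) :
    MDifferentiableAt (𝓡 n) (𝓡 n) (chart n x) p :=
  ((contMDiffOn_chart (I := 𝓡 n) (n := ∞) (x := x)).contMDiffAt
    ((chart n x).open_source.mem_nhds hp)).mdifferentiableAt (by simp)

theorem dChartSymm_eq {x x' : M} {y : Model n} (hy : y ∈ overlap n x x') :
    (dChartSymm x y : Model n →L[ℝ] Model n) =
      (dChartSymm x' (coordChange n x x' y) : Model n →L[ℝ] Model n).comp
        (fderiv ℝ (coordChange n x x') y) := by
  have h1 : (chart n x).symm =ᶠ[𝓝 y] (chart n x').symm ∘ coordChange n x x' := by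
    filter_upwards [(isOpen_overlap x x').mem_nhds hy] with z hz
    exact (symm_coordChange hz).symm
  have h2 := mfderiv_comp (I := 𝓡 n) (I' := 𝓡 n) (I'' := 𝓡 n) y
    (mdifferentiableAt_chart_symm (coordChange_mem_overlap hy).1)
    ((contDiffAt_coordChange hy).differentiableAt (by simp)).mdifferentiableAt
  rw [mfderiv_eq_fderiv] at h2
  exact h1.mfderiv_eq.trans h2

theorem dChart_comp_dChartSymm {x x' : M} {y : Model n} (hy : y ∈ overlap n x x') :
    (dChart x' ((chart n x).symm y)).comp (dChartSymm x y) = fderiv ℝ (coordChange n x x') y := by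
  have h2 := mfderiv_comp (I := 𝓡 n) (I' := 𝓡 n) (I'' := 𝓡 n) y
    (mdifferentiableAt_chart hy.2) (mdifferentiableAt_chart_symm hy.1)
  rw [← mfderiv_eq_fderiv]
  exact h2.symm

theorem dChart_comp_dChartSymm_self {x : M} {y : Model n} (hy : y ∈ (chart n x).target) :
    (dChart x ((chart n x).symm y) : Model n →L[ℝ] Model n).comp (dChartSymm x y) =
      ContinuousLinearMap.id ℝ (Model n) := by
  have h1 : coordChange n x x =ᶠ[𝓝 y] id := by
    filter_upwards [(chart n x).open_target.mem_nhds hy] with z hz using (chart n x).right_inv hz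
  exact (dChart_comp_dChartSymm ⟨hy, (chart n x).map_target hy⟩).trans
    (h1.fderiv_eq.trans fderiv_id)

theorem dChartSymm_self_comp_dChart (p : M) :
    (dChartSymm p (chart n p p) : Model n →L[ℝ] Model n).comp (dChart p p) =
      ContinuousLinearMap.id ℝ (Model n) := by
  have hp := mem_chart_source (Model n) p
  have h2 := mfderiv_comp (I := 𝓡 n) (I' := 𝓡 n) (I'' := 𝓡 n) p
    (mdifferentiableAt_chart_symm ((chart n p).map_source hp)) (mdifferentiableAt_chart hp)
  have h3 : (chart n p).symm ∘ chart n p =ᶠ[𝓝 p] id := by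
    filter_upwards [(chart n p).open_source.mem_nhds hp] with q hq using (chart n p).left_inv hq
  exact h2.symm.trans (h3.mfderiv_eq.trans mfderiv_id)

theorem rep_eq {k : ℕ} (θ : DiffForm n k M) {x x' : M} {y : Model n} (hy : y ∈ overlap n x x') :
    rep x θ y = (rep x' θ (coordChange n x x' y)).compContinuousLinearMap
      (fderiv ℝ (coordChange n x x') y) := by
  -- the type of the value of `θ` depends on the point, which has to be a variable to be rewritten
  have key : ∀ q, (chart n x').symm (coordChange n x x' y) = q →
      (θ q : Model n [⋀^Fin k]→L[ℝ] ℝ).compContinuousLinearMap (dChartSymm x y) =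
      (rep x' θ (coordChange n x x' y)).compContinuousLinearMap
      (fderiv ℝ (coordChange n x x') y) := by
    rintro q rfl
    rw [dChartSymm_eq hy]
    rfl
  exact key _ (symm_coordChange hy)

theorem gram_eq (g : RMetric n M) {x x' : M} {y : Model n} (hy : y ∈ overlap n x x') :
    gram g x y = ((Matrix.toEuclideanCLM (n := Fin n) (𝕜 := ℝ)).symm
        (fderiv ℝ (coordChange n x x') y)).transpose * gram g x' (coordChange n x x' y) *
      (Matrix.toEuclideanCLM (n := Fin n) (𝕜 := ℝ)).symm (fderiv ℝ (coordChange n x x') y) := by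
  set A := (Matrix.toEuclideanCLM (n := Fin n) (𝕜 := ℝ)).symm
        (fderiv ℝ (coordChange n x x') y) with hA
  have hA' : fderiv ℝ (coordChange n x x') y = Matrix.toEuclideanCLM (n := Fin n) (𝕜 := ℝ) A := by
    simp [hA]
  have key : ∀ q, (chart n x').symm (coordChange n x x' y) = q → ∀ i j,
      (g.inner q : Model n →L[ℝ] Model n →L[ℝ] ℝ) (dChartSymm x y (stdVec i))
        (dChartSymm x y (stdVec j)) =
      (A.transpose * gram g x' (coordChange n x x' y) * A) i j := by
    rintro q rfl i j
    rw [dChartSymm_eq hy, hA']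
    exact bilin_comp_toEuclideanCLM (g.inner ((chart n x').symm (coordChange n x x' y)))
      (dChartSymm x' (coordChange n x x' y)) A i j
  ext i j
  exact key _ (symm_coordChange hy) i j

end Charts

/-! ### Smooth families of alternating forms and of Gram matrices -/

section Smoothness

variable {n k : ℕ}

theorem contDiffOn_det {E : Type*} [NormedAddCommGroup E] [NormedSpace ℝ E] {s : Set E}
    {A : E → Matrix (Fin n) (Fin n) ℝ} (hA : ∀ i j, ContDiffOn ℝ ∞ (fun y => A y i j) s) :
    ContDiffOn ℝ ∞ (fun y => (A y).det) s := by
  simp only [Matrix.det_apply]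
  exact ContDiffOn.sum fun σ _ => (contDiffOn_prod fun i _ => hA _ _).const_smul _

theorem contDiffOn_inv_entry {E : Type*} [NormedAddCommGroup E] [NormedSpace ℝ E] {s : Set E}
    {A : E → Matrix (Fin n) (Fin n) ℝ} (hA : ∀ i j, ContDiffOn ℝ ∞ (fun y => A y i j) s)
    (h0 : ∀ y ∈ s, (A y).det ≠ 0) (i j : Fin n) : ContDiffOn ℝ ∞ (fun y => (A y)⁻¹ i j) s := by
  have h : ∀ y, (A y)⁻¹ i j = (A y).det⁻¹ * ((A y).updateRow j (Pi.single i 1)).det := by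
    intro y
    rw [Matrix.inv_def, Matrix.smul_apply, Matrix.adjugate_apply, Ring.inverse_eq_inv', smul_eq_mul]
  simp only [h]
  refine ((contDiffOn_det hA).inv h0).mul (contDiffOn_det fun a b => ?_)
  by_cases hab : a = j
  · subst hab
    simpa using contDiffOn_const
  · simpa [Matrix.updateRow_ne hab] using hA a b

/-- A family of alternating forms depends smoothly on a parameter if its coefficients do. -/
theorem contDiffOn_alternating_iff {E : Type*} [NormedAddCommGroup E] [NormedSpace ℝ E] {s : Set E}
    {r : WithTop ℕ∞} {c : E → Model n [⋀^Fin k]→L[ℝ] ℝ} :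
    ContDiffOn ℝ r c s ↔
      ∀ I : Fin k → Fin n, ContDiffOn ℝ r (fun y => c y fun a => stdVec (I a)) s := by
  constructor
  · intro h I
    exact (ContinuousAlternatingMap.apply ℝ (Model n) ℝ
      fun a => stdVec (I a)).contDiff.comp_contDiffOn h
  · intro h
    let T : (Model n [⋀^Fin k]→L[ℝ] ℝ) →ₗ[ℝ] ((Fin k → Fin n) → ℝ) :=
      ⟨⟨fun θ I => θ fun a => stdVec (I a), fun θ η => by ext; rfl⟩, fun c θ => by ext; rfl⟩
    obtain ⟨S, hS⟩ := T.exists_leftInverse_of_injective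
      (LinearMap.ker_eq_bot.mpr fun θ η hθ => ext_stdVec fun I => congrFun hθ I)
    have hc : c = fun y => S.toContinuousLinearMap (T (c y)) := by
      ext1 y
      exact (LinearMap.congr_fun hS (c y)).symm
    rw [hc]
    exact S.toContinuousLinearMap.contDiff.comp_contDiffOn (contDiffOn_pi.mpr h)

theorem contDiffOn_comp_matrix {E : Type*} [NormedAddCommGroup E] [NormedSpace ℝ E] {s : Set E}
    {c : E → Model n [⋀^Fin k]→L[ℝ] ℝ} {A : E → Matrix (Fin n) (Fin n) ℝ}
    (hc : ContDiffOn ℝ ∞ c s) (hA : ∀ i j, ContDiffOn ℝ ∞ (fun y => A y i j) s) :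
    ContDiffOn ℝ ∞ (fun y => (c y).compContinuousLinearMap
      (Matrix.toEuclideanCLM (n := Fin n) (𝕜 := ℝ) (A y))) s := by
  rw [contDiffOn_alternating_iff] at hc ⊢
  intro I
  simp only [ContinuousAlternatingMap.compContinuousLinearMap_apply, Function.comp_def,
    map_toEuclideanCLM_stdVec]
  exact ContDiffOn.sum fun K _ => (contDiffOn_prod fun a _ => hA _ _).mul (hc K)

theorem contDiffOn_comp_clm {E : Type*} [NormedAddCommGroup E] [NormedSpace ℝ E] {s : Set E}
    {c : E → Model n [⋀^Fin k]→L[ℝ] ℝ} {A : E → Model n →L[ℝ] Model n}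
    (hc : ContDiffOn ℝ ∞ c s) (hA : ContDiffOn ℝ ∞ A s) :
    ContDiffOn ℝ ∞ (fun y => (c y).compContinuousLinearMap (A y)) s := by
  have h := contDiffOn_comp_matrix hc
    (A := fun y => (Matrix.toEuclideanCLM (n := Fin n) (𝕜 := ℝ)).symm (A y)) (s := s) ?_
  · simpa using h
  · intro i j
    have e : ∀ B : Model n →L[ℝ] Model n,
        (Matrix.toEuclideanCLM (n := Fin n) (𝕜 := ℝ)).symm B i j = B (stdVec j) i := by
      intro B
      obtain ⟨B, rfl⟩ : ∃ B', Matrix.toEuclideanCLM (n := Fin n) (𝕜 := ℝ) B' = B :=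
        ⟨(Matrix.toEuclideanCLM (n := Fin n) (𝕜 := ℝ)).symm B, by simp⟩
      rw [toEuclideanCLM_stdVec]
      simp [stdVec, Pi.single_apply]
    simp only [e]
    exact (EuclideanSpace.proj (𝕜 := ℝ) i).contDiff.comp_contDiffOn
      (hA.clm_apply contDiffOn_const)

theorem contDiffOn_innerAlt {E : Type*} [NormedAddCommGroup E] [NormedSpace ℝ E] {s : Set E}
    {c d : E → Model n [⋀^Fin k]→L[ℝ] ℝ} {G : E → Matrix (Fin n) (Fin n) ℝ}
    (hc : ContDiffOn ℝ ∞ c s) (hd : ContDiffOn ℝ ∞ d s)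
    (hG : ∀ i j, ContDiffOn ℝ ∞ (fun y => G y i j) s) (h0 : ∀ y ∈ s, (G y).det ≠ 0) :
    ContDiffOn ℝ ∞ (fun y => innerAlt (G y) (c y) (d y)) s := by
  rw [contDiffOn_alternating_iff] at hc hd
  unfold innerAlt
  refine contDiffOn_const.mul (ContDiffOn.sum fun I _ => ContDiffOn.sum fun J _ => ?_)
  exact ((contDiffOn_prod fun a _ => contDiffOn_inv_entry hG h0 _ _).mul (hc I)).mul (hd J)

variable {M : Type*} [TopologicalSpace M] [ChartedSpace (Model n) M] [IsManifold (𝓡 n) ∞ M]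

theorem contMDiff_constSection (v : Model n) :
    ContMDiff (𝓡 n) ((𝓡 n).prod (𝓡 n)) ∞
      (fun y : Model n => (⟨y, v⟩ : TangentBundle (𝓡 n) (Model n))) := by
  exact contMDiff_vectorSpace_iff_contDiff.mpr contDiff_const

theorem contDiffOn_gram (g : RMetric n M) (x : M) (i j : Fin n) :
    ContDiffOn ℝ ∞ (fun y => gram g x y i j) (chart n x).target := by
  have hsymm := contMDiffOn_chart_symm (I := 𝓡 n) (n := ∞) (x := x)
  have hv : ∀ i : Fin n, ContMDiffOn (𝓡 n) ((𝓡 n).prod (𝓡 n)) ∞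
      (fun y => (⟨(chart n x).symm y, dChartSymm x y (stdVec i)⟩ : TangentBundle (𝓡 n) M))
      (chart n x).target := by
    intro i
    have h := (hsymm.contMDiffOn_tangentMapWithin (m := ∞) (by simp)
      (chart n x).open_target.uniqueMDiffOn).comp
      (contMDiff_constSection (stdVec i)).contMDiffOn (s := (chart n x).target) fun y hy => hy
    refine h.congr fun y hy => ?_
    simp only [tangentMapWithin, Function.comp, dChartSymm]
    rw [mfderivWithin_of_isOpen (chart n x).open_target hy]
    rfl
  have hg := g.contMDiff.comp_contMDiffOn hsymm
  have h : ContMDiffOn (𝓡 n) ((𝓡 n).prod 𝓘(ℝ)) ∞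
      (fun y => Bundle.TotalSpace.mk' ℝ (E := Bundle.Trivial M ℝ) ((chart n x).symm y)
        (g.inner ((chart n x).symm y) (dChartSymm x y (stdVec i)) (dChartSymm x y (stdVec j))))
      (chart n x).target := by
    apply ContMDiffOn.clm_bundle_apply₂ (F₁ := Model n) (F₂ := Model n)
    · exact hg
    · exact hv i
    · exact hv j
  intro y hy
  have h2 := h y hy
  rw [Bundle.contMDiffWithinAt_totalSpace] at h2
  exact contMDiffWithinAt_iff_contDiffWithinAt.mp h2.2

open scoped Matrix in
theorem bilin_sum_stdVec {n : ℕ} (b : Model n →L[ℝ] Model n →L[ℝ] ℝ) (D : Model n →L[ℝ] Model n)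
    (v : Fin n → ℝ) :
    b (D (∑ i, v i • stdVec i)) (D (∑ i, v i • stdVec i)) =
      star v ⬝ᵥ (Matrix.of fun a c => b (D (stdVec a)) (D (stdVec c))).mulVec v := by
  simp only [map_sum, map_smul, sum_apply, smul_apply, Matrix.mulVec, dotProduct, Matrix.of_apply,
    smul_eq_mul, Finset.mul_sum, star_trivial]
  rw [Finset.sum_comm]
  refine Finset.sum_congr rfl fun a _ => Finset.sum_congr rfl fun c _ => by ring

theorem posDef_gram (g : RMetric n M) {x : M} {y : Model n} (hy : y ∈ (chart n x).target) :
    (gram g x y).PosDef := by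
  have hinv : ∀ v : Model n, (dChartSymm x y : Model n →L[ℝ] Model n) v = 0 → v = 0 := by
    intro v hv
    have h1 := congrArg (fun T : Model n →L[ℝ] Model n => T v) (dChart_comp_dChartSymm_self hy)
    refine h1.symm.trans ?_
    change (dChart x ((chart n x).symm y) : Model n →L[ℝ] Model n)
      ((dChartSymm x y : Model n →L[ℝ] Model n) v) = 0
    rw [hv, map_zero]
  rw [Matrix.posDef_iff_dotProduct_mulVec]
  refine ⟨?_, fun v hv => ?_⟩
  · ext i j
    exact g.symm _ _ _
  · have hw : (∑ i, v i • stdVec i : Model n) ≠ 0 := by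
      intro h0
      apply hv
      ext i
      have := congrArg (fun w : Model n => w i) h0
      simpa [stdVec, Pi.single_apply] using this
    have hpos := g.pos ((chart n x).symm y) (dChartSymm x y (∑ i, v i • stdVec i))
      fun h0 => hw (hinv _ h0)
    refine hpos.trans_eq ?_
    exact bilin_sum_stdVec (g.inner ((chart n x).symm y)) (dChartSymm x y) v

end Smoothness

/-! ### Differential forms in charts -/

section FormsInCharts

theorem minSmoothness_two_le_infty : minSmoothness ℝ 2 ≤ (∞ : WithTop ℕ∞) := by
  rw [minSmoothness_of_isRCLikeNormedField]
  exact WithTop.coe_le_coe.mpr le_top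

variable {n k : ℕ} {M : Type*} [TopologicalSpace M] [ChartedSpace (Model n) M]

theorem rep_add (x : M) (θ η : DiffForm n k M) : rep x (θ + η) = rep x θ + rep x η := rfl

theorem rep_sub (x : M) (θ η : DiffForm n k M) : rep x (θ - η) = rep x θ - rep x η := rfl

theorem rep_smul (x : M) (c : ℝ) (θ : DiffForm n k M) : rep x (c • θ) = c • rep x θ := rfl

theorem IsSmooth.add {θ η : DiffForm n k M} (hθ : IsSmooth θ) (hη : IsSmooth η) :
    IsSmooth (θ + η) := fun x => (hθ x).add (hη x)

theorem IsSmooth.sub {θ η : DiffForm n k M} (hθ : IsSmooth θ) (hη : IsSmooth η) :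
    IsSmooth (θ - η) := fun x => (hθ x).sub (hη x)

theorem IsSmooth.const_smul {θ : DiffForm n k M} (hθ : IsSmooth θ) (c : ℝ) :
    IsSmooth (c • θ) := fun x => (hθ x).const_smul c

theorem IsSmooth.differentiableAt {θ : DiffForm n k M} (hθ : IsSmooth θ) {x : M} {y : Model n}
    (hy : y ∈ (chart n x).target) : DifferentiableAt ℝ (rep x θ) y :=
  ((hθ x).contDiffAt ((chart n x).open_target.mem_nhds hy)).differentiableAt (by simp)

theorem extD_add {θ η : DiffForm n k M} (hθ : IsSmooth θ) (hη : IsSmooth η) :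
    extD (θ + η) = extD θ + extD η := by
  ext1 p
  have hp := (chart n p).map_source (mem_chart_source (Model n) p)
  rw [extD, rep_add, extDeriv_add (hθ.differentiableAt hp) (hη.differentiableAt hp)]
  rfl

theorem extD_smul (c : ℝ) (θ : DiffForm n k M) : extD (c • θ) = c • extD θ := by
  ext1 p
  rw [extD, rep_smul, extDeriv_smul]
  rfl

theorem extD_sub {θ η : DiffForm n k M} (hθ : IsSmooth θ) (hη : IsSmooth η) :
    extD (θ - η) = extD θ - extD η := by
  ext1 p
  have hp := (chart n p).map_source (mem_chart_source (Model n) p)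
  have h : extDeriv (rep p θ - rep p η) (chart n p p) =
      extDeriv (rep p θ) (chart n p p) - extDeriv (rep p η) (chart n p p) := by
    rw [extDeriv, fderiv_sub (hθ.differentiableAt hp) (hη.differentiableAt hp)]
    exact (ContinuousAlternatingMap.alternatizeUncurryFinCLM ℝ (Model n) ℝ).map_sub _ _
  rw [extD, rep_sub, h]
  rfl

theorem isSmooth_zero : IsSmooth (0 : DiffForm n k M) := fun _ =>
  contDiffOn_const (c := (0 : Model n [⋀^Fin k]→L[ℝ] ℝ))

theorem extD_zero : extD (0 : DiffForm n k M) = 0 := by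
  simpa using extD_smul (0 : ℝ) (0 : DiffForm n k M)

theorem isSmooth_sum {ι : Type*} (s : Finset ι) {θ : ι → DiffForm n k M}
    (h : ∀ i, IsSmooth (θ i)) : IsSmooth (∑ i ∈ s, θ i) := by
  classical
  induction s using Finset.induction_on with
  | empty => simpa using isSmooth_zero
  | insert i s hi ih => rw [Finset.sum_insert hi]; exact (h i).add ih

theorem extD_sum {ι : Type*} (s : Finset ι) {θ : ι → DiffForm n k M} (h : ∀ i, IsSmooth (θ i)) :
    extD (∑ i ∈ s, θ i) = ∑ i ∈ s, extD (θ i) := by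
  classical
  induction s using Finset.induction_on with
  | empty => simpa using extD_zero
  | insert i s hi ih =>
    rw [Finset.sum_insert hi, Finset.sum_insert hi, extD_add (h i) (isSmooth_sum s h), ih]

/-- The exterior derivative does not increase the support. -/
theorem extD_eq_zero_of_notMem {θ : DiffForm n k M} {K : Set M} (hK : IsClosed K)
    (h0 : ∀ p ∉ K, θ p = 0) {p : M} (hp : p ∉ K) : extD θ p = 0 := by
  have hp' := (chart n p).map_source (mem_chart_source (Model n) p)
  have h : rep p θ =ᶠ[𝓝 (chart n p p)] fun _ => 0 := by
    have := (chart n p).isOpen_inter_preimage_symm hK.isOpen_compl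
    filter_upwards [this.mem_nhds ⟨hp', by simpa [(chart n p).left_inv (mem_chart_source _ p)]⟩]
      with z hz
    rw [rep, h0 _ hz.2]
    rfl
  have h2 : extDeriv (rep p θ) (chart n p p) = 0 := by
    rw [h.extDeriv_eq]
    rw [extDeriv, fderiv_fun_const]
    exact (ContinuousAlternatingMap.alternatizeUncurryFinCLM ℝ (Model n) ℝ).map_zero
  rw [extD, h2]
  rfl

open Classical in
/-- The form on `M` whose expression in the chart at `x` is `c`, extended by zero outside the domain
of the chart. -/
noncomputable def localForm (x : M) (c : Model n → Model n [⋀^Fin k]→L[ℝ] ℝ) : DiffForm n k M :=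
  fun p => if p ∈ (chart n x).source then (c (chart n x p)).compContinuousLinearMap (dChart x p)
    else 0

theorem localForm_eq_zero {x : M} {c : Model n → Model n [⋀^Fin k]→L[ℝ] ℝ} {K : Set (Model n)}
    (h0 : ∀ y ∉ K, c y = 0) {p : M}
    (hp : p ∉ (chart n x).symm '' K) : localForm x c p = 0 := by
  rw [localForm]
  split_ifs with h
  · rw [h0 (chart n x p) fun hpK => hp ⟨_, hpK, (chart n x).left_inv h⟩]
    rfl
  · rfl

theorem isCompact_symm_image {x : M} {K : Set (Model n)} (hK : K ⊆ (chart n x).target)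
    (hKc : IsCompact K) : IsCompact ((chart n x).symm '' K) :=
  hKc.image_of_continuousOn ((chart n x).continuousOn_symm.mono hK)

variable [IsManifold (𝓡 n) ∞ M]

theorem isUnit_det_fderiv_coordChange {x x' : M} {y : Model n} (hy : y ∈ overlap n x x') :
    IsUnit ((Matrix.toEuclideanCLM (n := Fin n) (𝕜 := ℝ)).symm
      (fderiv ℝ (coordChange n x x') y)).det := by
  refine Matrix.isUnit_det_of_left_inverse (B := (Matrix.toEuclideanCLM (n := Fin n) (𝕜 := ℝ)).symm
      (fderiv ℝ (coordChange n x' x) (coordChange n x x' y))) ?_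
  rw [← map_mul]
  exact (congrArg _ (fderiv_coordChange_comp hy)).trans (map_one _)

theorem innerAlt_rep_eq (g : RMetric n M) (θ η : DiffForm n k M) {x x' : M} {y : Model n}
    (hy : y ∈ overlap n x x') :
    innerAlt (gram g x y) (rep x θ y) (rep x η y) =
      innerAlt (gram g x' (coordChange n x x' y)) (rep x' θ (coordChange n x x' y))
        (rep x' η (coordChange n x x' y)) := by
  have h := innerAlt_comp (G := gram g x' (coordChange n x x' y)) (isUnit_det_fderiv_coordChange hy)
    (rep x' θ (coordChange n x x' y)) (rep x' η (coordChange n x x' y))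
  rw [← gram_eq g hy] at h
  rw [← h, rep_eq θ hy, rep_eq η hy]
  simp

/-- The pointwise inner product may be computed in any chart. -/
theorem formInner_symm (g : RMetric n M) (θ η : DiffForm n k M) {x : M} {y : Model n}
    (hy : y ∈ (chart n x).target) :
    formInner g θ η ((chart n x).symm y) = innerAlt (gram g x y) (rep x θ y) (rep x η y) :=
  (innerAlt_rep_eq g θ η (mem_overlap_self hy)).symm

theorem formInner_eq (g : RMetric n M) (θ η : DiffForm n k M) {x p : M}
    (hp : p ∈ (chart n x).source) :
    formInner g θ η p = innerAlt (gram g x (chart n x p)) (rep x θ (chart n x p))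
      (rep x η (chart n x p)) := by
  have h := formInner_symm g θ η ((chart n x).map_source hp)
  rwa [(chart n x).left_inv hp] at h

theorem posDef_gram_self (g : RMetric n M) (p : M) : (gram g p (chart n p p)).PosDef :=
  posDef_gram g ((chart n p).map_source (mem_chart_source _ p))

theorem det_gram_ne_zero (g : RMetric n M) {x : M} {y : Model n} (hy : y ∈ (chart n x).target) :
    (gram g x y).det ≠ 0 :=
  (posDef_gram g hy).det_pos.ne'

theorem IsSmooth.smul {θ : DiffForm n k M} (hθ : IsSmooth θ) {ρ : M → ℝ}
    (hρ : ContMDiff (𝓡 n) 𝓘(ℝ) ∞ ρ) : IsSmooth (fun p => ρ p • θ p : DiffForm n k M) := fun x =>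
  ContDiffOn.smul (contMDiffOn_iff_contDiffOn.mp (hρ.comp_contMDiffOn
    (contMDiffOn_chart_symm (I := 𝓡 n) (n := ∞) (x := x)))) (hθ x)

/-- The exterior derivative may be computed in any chart. -/
theorem rep_extD {θ : DiffForm n k M} (hθ : IsSmooth θ) {x : M} {y : Model n}
    (hy : y ∈ (chart n x).target) : rep x (extD θ) y = extDeriv (rep x θ) y := by
  have hy' := mem_overlap_self hy
  set q := (chart n x).symm y with hq
  have h1 : rep x θ =ᶠ[𝓝 y] fun z => (rep q θ (coordChange n x q z)).compContinuousLinearMap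
      (fderiv ℝ (coordChange n x q) z) := by
    filter_upwards [(isOpen_overlap x q).mem_nhds hy'] with z hz using rep_eq θ hz
  rw [h1.extDeriv_eq, extDeriv_pullback (hθ.differentiableAt (coordChange_mem_overlap hy').1)
    (contDiffAt_coordChange hy') minSmoothness_two_le_infty, ← dChart_comp_dChartSymm hy']
  rfl

theorem eventually_rep_extD {θ : DiffForm n k M} (hθ : IsSmooth θ) {x : M} {y : Model n}
    (hy : y ∈ (chart n x).target) : rep x (extD θ) =ᶠ[𝓝 y] extDeriv (rep x θ) := by
  filter_upwards [(chart n x).open_target.mem_nhds hy] with z hz using rep_extD hθ hz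

theorem IsSmooth.extD {θ : DiffForm n k M} (hθ : IsSmooth θ) : IsSmooth (extD θ) := by
  intro x
  refine ContDiffOn.congr ?_ fun y hy => rep_extD hθ hy
  exact (ContinuousAlternatingMap.alternatizeUncurryFinCLM ℝ (Model n) ℝ).contDiff.comp_contDiffOn
    ((hθ x).fderiv_of_isOpen (chart n x).open_target (m := ∞) (by simp))

theorem isClosedForm_extD {θ : DiffForm n k M} (hθ : IsSmooth θ) : IsClosedForm (extD θ) := by
  intro p
  have hp := (chart n p).map_source (mem_chart_source (Model n) p)
  have h : extDeriv (rep p (extD θ)) (chart n p p) = 0 := by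
    rw [(eventually_rep_extD hθ hp).extDeriv_eq]
    exact extDeriv_extDeriv_apply ((hθ p).contDiffAt ((chart n p).open_target.mem_nhds hp))
      minSmoothness_two_le_infty
  rw [GMS.extD, h]
  rfl

theorem contDiffOn_formInner (g : RMetric n M) {θ η : DiffForm n k M} (hθ : IsSmooth θ)
    (hη : IsSmooth η) (x : M) :
    ContDiffOn ℝ ∞ (fun y => formInner g θ η ((chart n x).symm y)) (chart n x).target :=
  (contDiffOn_innerAlt (hθ x) (hη x) (contDiffOn_gram g x) fun _ => det_gram_ne_zero g).congr
    fun _ => formInner_symm g θ η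

theorem continuous_formInner (g : RMetric n M) {θ η : DiffForm n k M} (hθ : IsSmooth θ)
    (hη : IsSmooth η) : Continuous (formInner g θ η) := by
  rw [continuous_iff_continuousAt]
  intro p
  have hp := mem_chart_source (Model n) p
  have h := ((contDiffOn_formInner g hθ hη p).continuousOn.continuousAt
    ((chart n p).open_target.mem_nhds ((chart n p).map_source hp))).comp
    ((chart n p).continuousAt hp)
  refine h.congr ?_
  filter_upwards [(chart n p).open_source.mem_nhds hp] with q hq
  simp only [Function.comp, (chart n p).left_inv hq]

theorem formInner_self_nonneg (g : RMetric n M) (θ : DiffForm n k M) (p : M) :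
    0 ≤ formInner g θ θ p :=
  innerAlt_self_nonneg (posDef_gram_self g p) _

theorem formInner_smul_left (g : RMetric n M) (ρ : M → ℝ) (θ η : DiffForm n k M) (p : M) :
    formInner g (fun q => ρ q • θ q) η p = ρ p * formInner g θ η p := by
  have h : rep p (fun q => ρ q • θ q : DiffForm n k M) (chart n p p) =
      ρ p • rep p θ (chart n p p) := by
    change ρ ((chart n p).symm (chart n p p)) • rep p θ (chart n p p) = _
    rw [(chart n p).left_inv (mem_chart_source _ p)]
  rw [formInner, h, innerAlt_smul_left]
  rfl

theorem isSmooth_gmsField (g : RMetric n M) {θ : DiffForm n k M} (hθ : IsSmooth θ) :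
    IsSmooth (gmsField g θ) := by
  intro x
  have h0 : ∀ p, 0 < 1 + formInner g θ θ p := fun p => by
    linarith [formInner_self_nonneg g θ p]
  have h1 : ContDiffOn ℝ ∞ (fun y => (√(1 + formInner g θ θ ((chart n x).symm y)))⁻¹)
      (chart n x).target :=
    ((contDiffOn_const.add (contDiffOn_formInner g hθ hθ x)).sqrt fun y _ => (h0 _).ne').inv
      fun y _ => (Real.sqrt_pos.mpr (h0 _)).ne'
  exact h1.smul (hθ x)

theorem contDiffOn_sqrtDet (g : RMetric n M) (x : M) :
    ContDiffOn ℝ ∞ (sqrtDet g x) (chart n x).target :=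
  (contDiffOn_det (contDiffOn_gram g x)).sqrt fun _ hy => det_gram_ne_zero g hy

theorem sqrtDet_pos (g : RMetric n M) {x : M} {y : Model n} (hy : y ∈ (chart n x).target) :
    0 < sqrtDet g x y :=
  Real.sqrt_pos.mpr (posDef_gram g hy).det_pos

theorem rep_localForm {x x' : M} (c : Model n → Model n [⋀^Fin k]→L[ℝ] ℝ) {y : Model n}
    (hy : y ∈ overlap n x' x) : rep x' (localForm x c) y =
      (c (coordChange n x' x y)).compContinuousLinearMap (fderiv ℝ (coordChange n x' x) y) := by
  have h : localForm x c ((chart n x').symm y) = _ := if_pos hy.2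
  rw [← dChart_comp_dChartSymm hy, rep, h]
  rfl

theorem rep_localForm_self {x : M} (c : Model n → Model n [⋀^Fin k]→L[ℝ] ℝ) {y : Model n}
    (hy : y ∈ (chart n x).target) : rep x (localForm x c) y = c y := by
  have hy' : y ∈ overlap n x x := ⟨hy, (chart n x).map_target hy⟩
  rw [rep_localForm c hy', ← dChart_comp_dChartSymm hy']
  refine (congrArg₂ (fun z D => (c z).compContinuousLinearMap D) ((chart n x).right_inv hy)
    (dChart_comp_dChartSymm_self hy)).trans ?_
  rfl

theorem isSmooth_localForm [T2Space M] {x : M} {c : Model n → Model n [⋀^Fin k]→L[ℝ] ℝ}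
    (hc : ContDiffOn ℝ ∞ c (chart n x).target) {K : Set (Model n)} (hK : K ⊆ (chart n x).target)
    (hKc : IsCompact K) (h0 : ∀ y ∉ K, c y = 0) : IsSmooth (localForm x c) := by
  intro x' y hy
  refine ContDiffAt.contDiffWithinAt ?_
  by_cases hyx : y ∈ overlap n x' x
  · have h1 : ContDiffOn ℝ ∞ (fun z => (c (coordChange n x' x z)).compContinuousLinearMap
        (fderiv ℝ (coordChange n x' x) z)) (overlap n x' x) :=
      contDiffOn_comp_clm (hc.comp (contDiffOn_coordChange x' x)
        fun z hz => (coordChange_mem_overlap hz).1)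
        ((contDiffOn_coordChange x' x).fderiv_of_isOpen (isOpen_overlap x' x) (by simp))
    refine (h1.contDiffAt ((isOpen_overlap x' x).mem_nhds hyx)).congr_of_eventuallyEq ?_
    filter_upwards [(isOpen_overlap x' x).mem_nhds hyx] with z hz using rep_localForm c hz
  · have hO := (chart n x').isOpen_inter_preimage_symm
      (isCompact_symm_image hK hKc).isClosed.isOpen_compl
    have hyO : (chart n x').symm y ∉ (chart n x).symm '' K := by
      rintro ⟨z, hz, hzy⟩
      exact hyx ⟨hy, by rw [mem_preimage, ← hzy]; exact (chart n x).map_target (hK hz)⟩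
    refine (contDiffAt_const (c := 0)).congr_of_eventuallyEq ?_
    filter_upwards [hO.mem_nhds ⟨hy, hyO⟩] with z hz
    rw [rep, localForm_eq_zero h0 hz.2]
    rfl

end FormsInCharts

/-! ### The Riemannian volume measure -/

section Volume

variable {n : ℕ} {M : Type*} [TopologicalSpace M] [ChartedSpace (Model n) M]

theorem measurableSet_target (x : M) : MeasurableSet (chart n x).target :=
  (chart n x).open_target.measurableSet

theorem measurableSet_target_inter [MeasurableSpace M] [BorelSpace M] (x : M)
    {S : Set M} (hS : MeasurableSet S) :
    MeasurableSet ((chart n x).symm ⁻¹' S ∩ (chart n x).target) := by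
  have h :=
    (continuousOn_iff_continuous_domRestrict.mp (chart n x).continuousOn_symm).measurable hS
  have h2 := (measurableSet_target x).subtype_image h
  convert h2 using 1
  ext y
  simp [and_comm]

theorem measurableSet_source_inter [MeasurableSpace M] [BorelSpace M] (x : M)
    {S : Set (Model n)} (hS : MeasurableSet S) :
    MeasurableSet (chart n x ⁻¹' S ∩ (chart n x).source) := by
  have h := ((continuousOn_iff_continuous_domRestrict.mp (chart n x).continuousOn).measurable hS)
  have h2 := (chart n x).open_source.measurableSet.subtype_image h
  convert h2 using 1
  ext y
  simp [and_comm]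

theorem aemeasurable_chart_symm [MeasurableSpace M] [BorelSpace M] (x : M) {ρ : Model n → ℝ≥0∞} :
    AEMeasurable (chart n x).symm ((volume.restrict (chart n x).target).withDensity ρ) :=
  ((chart n x).continuousOn_symm.aemeasurable (measurableSet_target x)).mono_ac
    (withDensity_absolutelyContinuous _ _)

variable [IsManifold (𝓡 n) ∞ M]

theorem sqrtDet_coordChange (g : RMetric n M) {x x' : M} {y : Model n}
    (hy : y ∈ overlap n x x') :
    sqrtDet g x y =
      |(fderiv ℝ (coordChange n x x') y).det| * sqrtDet g x' (coordChange n x x' y) := by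
  set A := (Matrix.toEuclideanCLM (n := Fin n) (𝕜 := ℝ)).symm
    (fderiv ℝ (coordChange n x x') y) with hA
  have hdet : (fderiv ℝ (coordChange n x x') y).det = A.det := by
    have hA' : fderiv ℝ (coordChange n x x') y =
        Matrix.toEuclideanCLM (n := Fin n) (𝕜 := ℝ) A := by simp [hA]
    rw [hA', ContinuousLinearMap.det, Matrix.coe_toEuclideanCLM_eq_toEuclideanLin]
    simp
  rw [hdet, sqrtDet, gram_eq g hy, ← hA, Matrix.det_mul, Matrix.det_mul, Matrix.det_transpose,
    sqrtDet, ← Real.sqrt_sq_eq_abs, ← Real.sqrt_mul (sq_nonneg _)]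
  congr 1
  ring

/-- The Riemannian volume density in the chart at `x`. -/
noncomputable def volumeDensity (g : RMetric n M) (x : M) (y : Model n) : ℝ≥0∞ :=
  ENNReal.ofReal (sqrtDet g x y)

theorem aemeasurable_volumeDensity (g : RMetric n M) (x : M) :
    AEMeasurable (volumeDensity g x) (volume.restrict (chart n x).target) :=
  ((contDiffOn_sqrtDet g x).continuousOn.aemeasurable (measurableSet_target x)).ennreal_ofReal

variable [MeasurableSpace M]

theorem chartVolume_le (g : RMetric n M) (x : M) : chartVolume g x ≤ riemVolume g :=
  le_iSup (chartVolume g) x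

variable [BorelSpace M]

theorem chartVolume_apply (g : RMetric n M) (x : M) {S : Set M} (hS : MeasurableSet S) :
    chartVolume g x S =
      ∫⁻ y in (chart n x).symm ⁻¹' S ∩ (chart n x).target, volumeDensity g x y := by
  rw [chartVolume, Measure.map_apply_of_aemeasurable (aemeasurable_chart_symm x) hS,
    withDensity_apply', Measure.restrict_restrict' (measurableSet_target x)]
  rfl

theorem lintegral_chartVolume (g : RMetric n M) (x : M) {f : M → ℝ≥0∞} (hf : Measurable f) :
    ∫⁻ p, f p ∂chartVolume g x =
      ∫⁻ y in (chart n x).target, volumeDensity g x y * f ((chart n x).symm y) := by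
  change ∫⁻ p, f p ∂(((volume.restrict (chart n x).target).withDensity (volumeDensity g x)).map
    (chart n x).symm) = _
  rw [lintegral_map' hf.aemeasurable (aemeasurable_chart_symm x),
    lintegral_withDensity_eq_lintegral_mul₀' (aemeasurable_volumeDensity g x)]
  · rfl
  · exact (hf.comp_aemeasurable (aemeasurable_chart_symm x))

theorem chartVolume_compl_source (g : RMetric n M) (x : M) :
    chartVolume g x (chart n x).sourceᶜ = 0 := by
  rw [chartVolume_apply g x (chart n x).open_source.measurableSet.compl]
  have : (chart n x).symm ⁻¹' (chart n x).sourceᶜ ∩ (chart n x).target = ∅ := by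
    ext y
    simp only [mem_inter_iff, mem_preimage, mem_compl_iff, mem_empty_iff_false, iff_false, not_and]
    intro h1 h2
    exact h1 ((chart n x).map_target h2)
  rw [this, setLIntegral_empty]

/-- The volumes computed in two charts agree on the overlap of their domains: this is the change of
variables formula. -/
theorem chartVolume_eq_of_subset (g : RMetric n M) {x x' : M} {S : Set M} (hS : MeasurableSet S)
    (h : S ⊆ (chart n x).source) (h' : S ⊆ (chart n x').source) :
    chartVolume g x S = chartVolume g x' S := by
  rw [chartVolume_apply g x hS, chartVolume_apply g x' hS]
  set A := (chart n x).symm ⁻¹' S ∩ (chart n x).target with hA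
  have hAO : ∀ y ∈ A, y ∈ overlap n x x' := fun y hy => ⟨hy.2, h' hy.1⟩
  have hB : (chart n x').symm ⁻¹' S ∩ (chart n x').target = coordChange n x x' '' A := by
    ext z
    constructor
    · intro hz
      have hzO : z ∈ overlap n x' x := ⟨hz.2, h hz.1⟩
      refine ⟨coordChange n x' x z, ⟨?_, (coordChange_mem_overlap hzO).1⟩,
        coordChange_coordChange hzO⟩
      rw [mem_preimage, symm_coordChange hzO]
      exact hz.1
    · rintro ⟨y, hy, rfl⟩
      refine ⟨?_, (coordChange_mem_overlap (hAO y hy)).1⟩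
      rw [mem_preimage, symm_coordChange (hAO y hy)]
      exact hy.1
  have hAm : MeasurableSet A := measurableSet_target_inter x hS
  rw [hB, lintegral_image_eq_lintegral_abs_det_fderiv_mul volume hAm
    (fun y hy => ((contDiffAt_coordChange (hAO y hy)).differentiableAt
      (by simp)).hasFDerivAt.hasFDerivWithinAt)
    (fun y hy z hz hyz => by
      rw [← coordChange_coordChange (hAO y hy), hyz, coordChange_coordChange (hAO z hz)])]
  refine setLIntegral_congr_fun hAm fun y hy => ?_
  simp only [volumeDensity]
  rw [sqrtDet_coordChange g (hAO y hy), ENNReal.ofReal_mul (abs_nonneg _)]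

/-- The volume measure restricts to the volume of each chart. For the upper bound, the sum of the
volume of the chart and of the volume measure outside of the domain of the chart dominates the
volume of every other chart. -/
theorem riemVolume_restrict_source (g : RMetric n M) (x : M) :
    (riemVolume g).restrict (chart n x).source = chartVolume g x := by
  have hO : MeasurableSet (chart n x).source := (chart n x).open_source.measurableSet
  have hnull : ∀ (z : M) (S : Set M),
      chartVolume g z S = chartVolume g z (S ∩ (chart n z).source) :=
    fun z S => (measure_inter_conull (chartVolume_compl_source g z)).symm
  refine le_antisymm ?_ ?_
  · have hle : riemVolume g ≤ chartVolume g x + (riemVolume g).restrict (chart n x).sourceᶜ := by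
      refine iSup_le fun z => Measure.le_iff.mpr fun S hS => ?_
      rw [Measure.add_apply, Measure.restrict_apply hS, ← measure_inter_add_sdiff S hO]
      refine add_le_add ?_ (chartVolume_le g z _)
      rw [hnull z]
      have hm : MeasurableSet (S ∩ (chart n x).source ∩ (chart n z).source) :=
        (hS.inter hO).inter (chart n z).open_source.measurableSet
      rw [chartVolume_eq_of_subset g hm inter_subset_right
        (inter_subset_left.trans inter_subset_right)]
      exact measure_mono (inter_subset_left.trans inter_subset_left)
    refine Measure.le_iff.mpr fun S hS => ?_
    rw [Measure.restrict_apply hS]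
    refine (hle _).trans ?_
    rw [Measure.add_apply, Measure.restrict_apply (hS.inter hO)]
    have : S ∩ (chart n x).source ∩ (chart n x).sourceᶜ = ∅ := by
      rw [inter_assoc, inter_compl_self, inter_empty]
    rw [this, measure_empty, add_zero]
    exact measure_mono inter_subset_left
  · refine Measure.le_iff.mpr fun S hS => ?_
    rw [Measure.restrict_apply hS, hnull x]
    exact chartVolume_le g x _

/-- A property holds almost everywhere on `M` if it holds almost everywhere in every chart. -/
theorem ae_riemVolume [CompactSpace M] (g : RMetric n M) {P : M → Prop}
    (h : ∀ x : M, ∀ᵐ y ∂volume.restrict (chart n x).target, P ((chart n x).symm y)) :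
    ∀ᵐ p ∂riemVolume g, P p := by
  have hx : ∀ x : M, ∀ᵐ p ∂(riemVolume g).restrict (chart n x).source, P p := by
    intro x
    rw [riemVolume_restrict_source]
    set N := toMeasurable (volume.restrict (chart n x).target) {y | ¬ P ((chart n x).symm y)}
      with hN
    have hN0 : volume.restrict (chart n x).target N = 0 := by
      rw [hN, measure_toMeasurable]
      exact h x
    have hS : MeasurableSet (chart n x ⁻¹' N ∩ (chart n x).source) :=
      measurableSet_source_inter x (measurableSet_toMeasurable _ _)
    have h0 : chartVolume g x (chart n x ⁻¹' N ∩ (chart n x).source) = 0 := by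
      rw [chartVolume_apply g x hS]
      refine setLIntegral_measure_zero _ _ ?_
      rw [Measure.restrict_apply (measurableSet_toMeasurable _ _)] at hN0
      refine measure_mono_null (fun y hy => mem_inter ?_ hy.2) hN0
      have := hy.1.1
      rwa [mem_preimage, (chart n x).right_inv hy.2] at this
    have h1 := measure_union_null h0 (chartVolume_compl_source g x)
    refine measure_mono_null (fun p hp => ?_) h1
    by_cases hpx : p ∈ (chart n x).source
    · refine Or.inl ⟨subset_toMeasurable _ _ ?_, hpx⟩
      simpa [(chart n x).left_inv hpx] using hp
    · exact Or.inr hpx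
  obtain ⟨t, ht⟩ := isCompact_univ.elim_finite_subcover (fun x : M => (chart n x).source)
    (fun x => (chart n x).open_source) fun p _ => mem_iUnion.mpr ⟨p, mem_chart_source _ p⟩
  rw [← Measure.restrict_univ (μ := riemVolume g)]
  refine ae_mono (Measure.restrict_mono ht le_rfl) ?_
  exact (ae_restrict_biUnion_finset_iff (fun x : M => (chart n x).source) t P).mpr fun x _ => hx x

theorem riemVolume_symm_image_lt_top [T2Space M] (g : RMetric n M) {x : M} {K : Set (Model n)}
    (hK : K ⊆ (chart n x).target) (hKc : IsCompact K) :
    riemVolume g ((chart n x).symm '' K) < ⊤ := by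
  have hm : MeasurableSet ((chart n x).symm '' K) := (isCompact_symm_image hK hKc).measurableSet
  have hsub : (chart n x).symm '' K ⊆ (chart n x).source := by
    rintro _ ⟨y, hy, rfl⟩
    exact (chart n x).map_target (hK hy)
  rw [← inter_eq_left.mpr hsub, ← Measure.restrict_apply hm, riemVolume_restrict_source,
    chartVolume_apply g x hm]
  have hKeq : (chart n x).symm ⁻¹' ((chart n x).symm '' K) ∩ (chart n x).target = K := by
    ext y
    constructor
    · rintro ⟨⟨z, hz, hzy⟩, hy⟩
      rwa [← (chart n x).symm.injOn (hK hz) hy hzy]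
    · exact fun hy => ⟨mem_image_of_mem _ hy, hK hy⟩
  rw [hKeq]
  have hint : IntegrableOn (sqrtDet g x) K :=
    ((contDiffOn_sqrtDet g x).continuousOn.mono hK).integrableOn_compact hKc
  exact hint.setLIntegral_lt_top

theorem isFiniteMeasure_riemVolume [T2Space M] [CompactSpace M] (g : RMetric n M) :
    IsFiniteMeasure (riemVolume g) := by
  have : IsLocallyFiniteMeasure (riemVolume g) := by
    refine ⟨fun p => ?_⟩
    obtain ⟨r, hr, hball⟩ := Metric.nhds_basis_closedBall.mem_iff.mp
      ((chart n p).open_target.mem_nhds ((chart n p).map_source (mem_chart_source _ p)))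
    refine ⟨(chart n p).symm '' Metric.closedBall (chart n p p) r, ?_,
      riemVolume_symm_image_lt_top g hball (isCompact_closedBall _ _)⟩
    have := (chart n p).symm.image_mem_nhds
      ((chart n p).map_source (mem_chart_source (Model n) p)) (Metric.closedBall_mem_nhds _ hr)
    rwa [(chart n p).left_inv (mem_chart_source _ p)] at this
  exact ⟨isCompact_univ.measure_lt_top⟩

theorem integrable_of_continuous [T2Space M] [CompactSpace M] (g : RMetric n M) {f : M → ℝ}
    (hf : Continuous f) : Integrable f (riemVolume g) := by
  have := isFiniteMeasure_riemVolume g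
  obtain ⟨C, hC⟩ := isCompact_univ.exists_bound_of_continuousOn hf.continuousOn
  exact Integrable.of_bound hf.aestronglyMeasurable C
    (Eventually.of_forall fun p => hC p (mem_univ p))

/-- The integral over `M` of a function vanishing outside of the domain of a chart. -/
theorem integral_eq_setIntegral_target (g : RMetric n M) {x : M} {f : M → ℝ}
    (hf : ContinuousOn f (chart n x).source) (h0 : ∀ p ∉ (chart n x).source, f p = 0) :
    ∫ p, f p ∂riemVolume g = ∫ y in (chart n x).target, sqrtDet g x y * f ((chart n x).symm y) := by
  have hO : MeasurableSet (chart n x).source := (chart n x).open_source.measurableSet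
  have hfm := hf.aestronglyMeasurable (μ := riemVolume g) hO
  rw [← setIntegral_eq_integral_of_forall_compl_eq_zero h0]
  rw [riemVolume_restrict_source] at hfm ⊢
  change AEStronglyMeasurable f
    (((volume.restrict (chart n x).target).withDensity (volumeDensity g x)).map
      (chart n x).symm) at hfm
  change ∫ p, f p ∂(((volume.restrict (chart n x).target).withDensity (volumeDensity g x)).map
    (chart n x).symm) = _
  rw [integral_map (aemeasurable_chart_symm x) hfm,
    integral_withDensity_eq_integral_toReal_smul₀ (aemeasurable_volumeDensity g x)
      (Eventually.of_forall fun y => ENNReal.ofReal_lt_top)]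
  refine setIntegral_congr_fun (measurableSet_target x) fun y hy => ?_
  simp only [smul_eq_mul, volumeDensity]
  rw [ENNReal.toReal_ofReal (sqrtDet_pos g hy).le]

end Volume

/-! ### Divergences in charts and the fundamental lemma -/

section Green

variable {n k : ℕ}

theorem integrableOn_of_eq_zero_off_compact {F : Type*} [NormedAddCommGroup F]
    {U K : Set (Model n)} (hU : IsOpen U) (hK : K ⊆ U) (hKc : IsCompact K) {f : Model n → F}
    (hf : ContinuousOn f U)
    (h0 : ∀ y ∈ U, y ∉ K → f y = 0) : IntegrableOn f U :=
  ((hf.mono hK).integrableOn_compact hKc).of_forall_sdiff_eq_zero hU.measurableSet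
    fun y hy => h0 y hy.1 hy.2

theorem setIntegral_fderiv_eq_zero {F : Type*} [NormedAddCommGroup F] [NormedSpace ℝ F]
    {U K : Set (Model n)} (hU : IsOpen U) (hK : K ⊆ U) (hKc : IsCompact K) {u : Model n → F}
    (hu : ContDiffOn ℝ ∞ u U)
    (h0 : ∀ y ∈ U, y ∉ K → u y = 0) (v : Model n) :
    IntegrableOn (fun y => fderiv ℝ u y v) U ∧ ∫ y in U, fderiv ℝ u y v = 0 := by
  set w := U.indicator u with hw
  have hwU : ∀ y ∈ U, w =ᶠ[𝓝 y] u := fun y hy => by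
    filter_upwards [hU.mem_nhds hy] with z hz using indicator_of_mem hz u
  have hwK : ∀ y ∉ K, w y = 0 := fun y hy => by
    by_cases hyU : y ∈ U
    · rw [hw, indicator_of_mem hyU, h0 y hyU hy]
    · rw [hw, indicator_of_notMem hyU]
  have hwK' : ∀ y ∉ K, w =ᶠ[𝓝 y] fun _ => 0 := fun y hy => by
    filter_upwards [hKc.isClosed.isOpen_compl.mem_nhds hy] with z hz using hwK z hz
  have hwd : ContDiff ℝ ∞ w := by
    rw [contDiff_iff_contDiffAt]
    intro y
    by_cases hy : y ∈ U
    · exact (hu.contDiffAt (hU.mem_nhds hy)).congr_of_eventuallyEq (hwU y hy)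
    · exact contDiffAt_const.congr_of_eventuallyEq (hwK' y fun h => hy (hK h))
  have hwc : HasCompactSupport w := HasCompactSupport.intro hKc hwK
  have hint : Integrable (fun y => fderiv ℝ w y v) := by
    refine Continuous.integrable_of_hasCompactSupport
      ((hwd.continuous_fderiv (by simp)).clm_apply continuous_const) ?_
    exact (hwc.fderiv (𝕜 := ℝ)).comp_left (g := fun L : Model n →L[ℝ] F => L v) rfl
  have hzero : ∫ y, fderiv ℝ w y v = 0 := by
    have h := integral_smul_fderiv_eq_neg_fderiv_smul_of_integrable (𝕜 := ℝ) (μ := volume)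
      (f := fun _ : Model n => (1 : ℝ)) (g := w) (v := v) (by simp) (by simpa using hint)
      (by simpa using hwd.continuous.integrable_of_hasCompactSupport hwc)
      (fun _ _ => differentiableAt_const _)
      (fun y _ => hwd.differentiable (by simp) y)
    simpa using h
  have heq : EqOn (fun y => fderiv ℝ w y v) (fun y => fderiv ℝ u y v) U := fun y hy => by
    simp only [(hwU y hy).fderiv_eq]
  refine ⟨hint.integrableOn.congr_fun heq hU.measurableSet, ?_⟩
  rw [← setIntegral_congr_fun hU.measurableSet heq,
    setIntegral_eq_integral_of_forall_compl_eq_zero, hzero]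
  intro y hy
  rw [(hwK' y fun h => hy (hK h)).fderiv_eq]
  simp

/-- The fundamental lemma of the calculus of variations, for continuous functions. -/
theorem eq_zero_of_forall_integral_smul_eq_zero {U Ω : Set (Model n)} (hU : IsOpen U)
    (hUΩ : U ⊆ Ω) {f : Model n → ℝ} (hf : ContinuousOn f U)
    (h : ∀ χ : Model n → ℝ, ContDiff ℝ ∞ χ → HasCompactSupport χ → tsupport χ ⊆ U →
      ∫ y in Ω, χ y * f y = 0) : ∀ y ∈ U, f y = 0 := by
  have hae := hU.ae_eq_zero_of_integral_contDiff_smul_eq_zero (μ := volume) (f := f)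
    (hf.locallyIntegrableOn hU.measurableSet) (fun χ hχ hχc hχU => by
      rw [← h χ hχ hχc hχU, setIntegral_eq_integral_of_forall_compl_eq_zero]
      · rfl
      · intro y hy
        rw [image_eq_zero_of_notMem_tsupport fun hyc => hy (hUΩ (hχU hyc)), zero_mul])
  exact Measure.eqOn_open_of_ae_eq (g := fun _ => (0 : ℝ))
    ((ae_restrict_iff' hU.measurableSet).mpr hae) hU hf continuousOn_const

variable {M : Type*} [TopologicalSpace M] [ChartedSpace (Model n) M] [IsManifold (𝓡 n) ∞ M]

/-- The form `√det g · θ` with raised indices, in the chart at `x`. Its divergence is, up to sign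
and normalization, the codifferential. -/
noncomputable def raisedDensity (g : RMetric n M) (x : M) (θ : DiffForm n k M) (z : Model n) :
    Model n [⋀^Fin k]→L[ℝ] ℝ :=
  sqrtDet g x z • (rep x θ z).compContinuousLinearMap
      (Matrix.toEuclideanCLM (n := Fin n) (𝕜 := ℝ) (gram g x z)⁻¹)

theorem contDiffOn_raisedDensity (g : RMetric n M) {θ : DiffForm n k M} (hθ : IsSmooth θ) (x : M) :
    ContDiffOn ℝ ∞ (raisedDensity g x θ) (chart n x).target :=
  (contDiffOn_sqrtDet g x).smul (contDiffOn_comp_matrix (hθ x)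
    (contDiffOn_inv_entry (contDiffOn_gram g x) fun _ => det_gram_ne_zero g))

theorem contDiffOn_codiffRep (g : RMetric n M) {θ : DiffForm n (k + 1) M} (hθ : IsSmooth θ)
    (x : M) : ContDiffOn ℝ ∞ (codiffRep g x θ) (chart n x).target := by
  refine contDiffOn_comp_matrix ?_ (contDiffOn_gram g x)
  refine ContDiffOn.smul ((contDiffOn_sqrtDet g x).inv fun y hy => (sqrtDet_pos g hy).ne').neg
    (ContDiffOn.sum fun i _ => ?_)
  have h1 : ContDiffOn ℝ ∞ (fun y => fderiv ℝ (raisedDensity g x θ) y (stdVec i))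
      (chart n x).target :=
    ((contDiffOn_raisedDensity g hθ x).fderiv_of_isOpen (chart n x).open_target (m := ∞)
      (by simp)).clm_apply contDiffOn_const
  exact ((ContinuousAlternatingMap.curryLeftLI (𝕜 := ℝ) (E := Model n) (F := ℝ)
    (n := k)).toContinuousLinearMap.contDiff.comp_contDiffOn h1).clm_apply
      contDiffOn_const

/-- In a chart the difference of `(θ, dψ)` and `(d^*θ, ψ)` is a divergence. -/
theorem sqrtDet_mul_innerAlt_extDeriv_sub (g : RMetric n M) {θ : DiffForm n (k + 1) M}
    {ψ : DiffForm n k M} (hθ : IsSmooth θ) (hψ : IsSmooth ψ) {x : M} {y : Model n}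
    (hy : y ∈ (chart n x).target) :
    sqrtDet g x y * innerAlt (gram g x y) (rep x θ y) (extDeriv (rep x ψ) y) -
      sqrtDet g x y * innerAlt (gram g x y) (codiffRep g x θ y) (rep x ψ y) =
    (k.factorial : ℝ)⁻¹ * ∑ i : Fin n, ∑ J : Fin k → Fin n,
      fderiv ℝ (fun z => (raisedDensity g x θ z).curryLeft (stdVec i) (fun a => stdVec (J a)) *
        rep x ψ z (fun a => stdVec (J a))) y (stdVec i) := by
  have hG := isUnit_iff_ne_zero.mpr (det_gram_ne_zero g hy)
  have hs := (sqrtDet_pos g hy).ne'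
  have hW := ((contDiffOn_raisedDensity g hθ x).contDiffAt
    ((chart n x).open_target.mem_nhds hy)).differentiableAt (by simp)
  have hc := hψ.differentiableAt hy
  -- by antisymmetry only the first slot of the alternated derivative of `ψ` matters
  have h1 : sqrtDet g x y * innerAlt (gram g x y) (rep x θ y) (extDeriv (rep x ψ) y) =
      (k.factorial : ℝ)⁻¹ * ∑ i : Fin n, ∑ J : Fin k → Fin n,
        (raisedDensity g x θ y).curryLeft (stdVec i) (fun a => stdVec (J a)) *
          fderiv ℝ (rep x ψ) y (stdVec i) (fun a => stdVec (J a)) := by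
    rw [← sum_mul_alternatizeUncurryFin, innerAlt_eq_sum, mul_left_comm, Finset.mul_sum]
    congr 1
    refine Finset.sum_congr rfl fun J _ => ?_
    rw [← mul_assoc]
    rfl
  -- lowering the indices in `codiffRep` undoes the raising of indices in the inner product
  have h2 : sqrtDet g x y * innerAlt (gram g x y) (codiffRep g x θ y) (rep x ψ y) =
      -((k.factorial : ℝ)⁻¹ * ∑ i : Fin n, ∑ J : Fin k → Fin n,
        (fderiv ℝ (raisedDensity g x θ) y (stdVec i)).curryLeft (stdVec i)
          (fun a => stdVec (J a)) * rep x ψ y (fun a => stdVec (J a))) := by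
    rw [codiffRep, innerAlt_lower hG, Finset.sum_comm, mul_left_comm, ← mul_neg, Finset.mul_sum,
      ← Finset.sum_neg_distrib]
    congr 1
    refine Finset.sum_congr rfl fun J _ => ?_
    rw [← Finset.sum_mul, ContinuousAlternatingMap.smul_apply, ContinuousAlternatingMap.sum_apply,
      smul_eq_mul]
    have : ∀ S r : ℝ, sqrtDet g x y * (-(sqrtDet g x y)⁻¹ * S * r) = -(S * r) := by
      intro S r
      field_simp
    exact this _ _
  rw [h1, h2, sub_neg_eq_add, ← mul_add, ← Finset.sum_add_distrib]
  congr 1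
  refine Finset.sum_congr rfl fun i _ => ?_
  rw [← Finset.sum_add_distrib]
  refine Finset.sum_congr rfl fun J _ => ?_
  have d1 : HasFDerivAt (fun z => (raisedDensity g x θ z).curryLeft (stdVec i)
      (fun a => stdVec (J a))) ((ContinuousAlternatingMap.apply ℝ (Model n) ℝ
        (Matrix.vecCons (stdVec i) fun a => stdVec (J a))).comp
          (fderiv ℝ (raisedDensity g x θ) y)) y :=
    (ContinuousAlternatingMap.apply ℝ (Model n) ℝ
        (Matrix.vecCons (stdVec i) fun a => stdVec (J a))).hasFDerivAt.comp y hW.hasFDerivAt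
  have d2 : HasFDerivAt (fun z => rep x ψ z (fun a => stdVec (J a)))
      ((ContinuousAlternatingMap.apply ℝ (Model n) ℝ fun a => stdVec (J a)).comp
          (fderiv ℝ (rep x ψ) y)) y :=
    (ContinuousAlternatingMap.apply ℝ (Model n) ℝ fun a => stdVec (J a)).hasFDerivAt.comp y
      hc.hasFDerivAt
  rw [(d1.fun_mul d2).fderiv]
  simp only [add_apply, smul_apply, smul_eq_mul]
  refine congrArg₂ (· + ·) rfl ?_
  rw [mul_comm]
  rfl

end Green

/-! ### Green's formula and the codifferential -/

section Codifferential

variable {n k : ℕ} {M : Type*} [TopologicalSpace M] [ChartedSpace (Model n) M]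
  [IsManifold (𝓡 n) ∞ M]

/-- A left inverse is a two-sided inverse in finite dimension, so pulling back along `D` is
injective on forms. -/
theorem eq_zero_of_comp_eq_zero {n k : ℕ} {D S : Model n →L[ℝ] Model n}
    (hSD : S.comp D = ContinuousLinearMap.id ℝ (Model n)) {T : Model n [⋀^Fin k]→L[ℝ] ℝ}
    (h : T.compContinuousLinearMap D = 0) : T = 0 := by
  have hinj : Function.Injective D.toLinearMap := Function.LeftInverse.injective (g := S)
    fun v => congrArg (fun T : Model n →L[ℝ] Model n => T v) hSD
  have hsurj := LinearMap.injective_iff_surjective.mp hinj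
  ext v
  choose w hw using fun a => hsurj (v a)
  have h2 := congrArg (fun T : Model n [⋀^Fin k]→L[ℝ] ℝ => T w) h
  rw [← funext hw]
  exact h2

theorem formInner_add_right (g : RMetric n M) (θ η η' : DiffForm n k M) (p : M) :
    formInner g θ (η + η') p = formInner g θ η p + formInner g θ η' p := by
  rw [formInner, rep_add]
  exact innerAlt_add_right _ _ _ _

theorem formInner_eq_zero_of_right (g : RMetric n M) (θ : DiffForm n k M) {η : DiffForm n k M}
    {p : M} (h : η p = 0) : formInner g θ η p = 0 := by
  have h2 : rep p η (chart n p p) = 0 := by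
    have key : ∀ q, q = p → (η q : Model n [⋀^Fin k]→L[ℝ] ℝ) = 0 := by
      rintro q rfl
      exact h
    have h3 : η ((chart n p).symm (chart n p p)) = 0 :=
      key _ ((chart n p).left_inv (mem_chart_source _ p))
    rw [rep, h3]
    rfl
  rw [formInner, h2, innerAlt_zero_right]

theorem formInner_sum_right {ι : Type*} (g : RMetric n M) (θ : DiffForm n k M) (s : Finset ι)
    (η : ι → DiffForm n k M) (p : M) :
    formInner g θ (∑ i ∈ s, η i) p = ∑ i ∈ s, formInner g θ (η i) p := by
  classical
  induction s using Finset.induction_on with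
  | empty => simpa using formInner_eq_zero_of_right g θ rfl
  | insert i s hi ih => rw [Finset.sum_insert hi, Finset.sum_insert hi, formInner_add_right, ih]

theorem continuousOn_formInner (g : RMetric n M) {θ η : DiffForm n k M} {x : M}
    (hθ : ContDiffOn ℝ ∞ (rep x θ) (chart n x).target)
    (hη : ContDiffOn ℝ ∞ (rep x η) (chart n x).target) :
    ContinuousOn (formInner g θ η) (chart n x).source := by
  have h := contDiffOn_innerAlt hθ hη (contDiffOn_gram g x) fun _ => det_gram_ne_zero g
  refine (h.continuousOn.comp (chart n x).continuousOn (chart n x).mapsTo).congr fun p hp => ?_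
  exact formInner_eq g θ η hp

/-- Test forms: constant forms in a chart, multiplied by a cut-off function. -/
theorem isSmooth_testForm [T2Space M] {x : M} {χ : Model n → ℝ} (hχ : ContDiff ℝ ∞ χ)
    (hχc : HasCompactSupport χ) (hχx : tsupport χ ⊆ (chart n x).target)
    (η : Model n [⋀^Fin k]→L[ℝ] ℝ) : IsSmooth (localForm x fun y => χ y • η) :=
  isSmooth_localForm (hχ.smul contDiff_const).contDiffOn hχx hχc fun y hy => by
    rw [image_eq_zero_of_notMem_tsupport hy, zero_smul]

variable [MeasurableSpace M] [BorelSpace M] [T2Space M]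

/-- Green's formula for a form `ψ` with compact support in the domain of a chart. -/
theorem integral_formInner_extD (g : RMetric n M) {θ : DiffForm n (k + 1) M}
    {ψ : DiffForm n k M} (hθ : IsSmooth θ) (hψ : IsSmooth ψ) {x : M} {K : Set (Model n)}
    (hK : K ⊆ (chart n x).target) (hKc : IsCompact K)
    (h0 : ∀ p ∉ (chart n x).symm '' K, ψ p = 0) :
    ∫ p, formInner g θ (extD ψ) p ∂riemVolume g =
      ∫ y in (chart n x).target,
        sqrtDet g x y * innerAlt (gram g x y) (codiffRep g x θ y) (rep x ψ y) := by
  have hO := (chart n x).open_target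
  have hKM := (isCompact_symm_image hK hKc).isClosed
  have hsub : (chart n x).symm '' K ⊆ (chart n x).source := by
    rintro _ ⟨y, hy, rfl⟩
    exact (chart n x).map_target (hK hy)
  have hnot : ∀ y ∈ (chart n x).target, y ∉ K → (chart n x).symm y ∉ (chart n x).symm '' K := by
    rintro y hy hyK ⟨z, hz, hzy⟩
    rw [← (chart n x).symm.injOn hy (hK hz) hzy.symm] at hz
    exact hyK hz
  have hd0 : ∀ p ∉ (chart n x).symm '' K, formInner g θ (extD ψ) p = 0 := fun p hp =>
    formInner_eq_zero_of_right g θ (extD_eq_zero_of_notMem hKM h0 hp)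
  have hr0 : ∀ y ∈ (chart n x).target, y ∉ K → rep x ψ y = 0 := fun y hy hyK => by
    rw [rep, h0 _ (hnot y hy hyK)]
    rfl
  rw [integral_eq_setIntegral_target g (x := x)
    (continuous_formInner g hθ hψ.extD).continuousOn fun p hp => hd0 p fun h => hp (hsub h)]
  have hu : ∀ (i : Fin n) (J : Fin k → Fin n), _ := fun i J =>
    setIntegral_fderiv_eq_zero hO hK hKc
      (u := fun z => (raisedDensity g x θ z).curryLeft (stdVec i) (fun a => stdVec (J a)) *
        rep x ψ z (fun a => stdVec (J a)))
      (((ContinuousAlternatingMap.apply ℝ (Model n) ℝ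
        (Matrix.vecCons (stdVec i) fun a => stdVec (J a))).contDiff.comp_contDiffOn
          (contDiffOn_raisedDensity g hθ x)).mul
        (contDiffOn_alternating_iff.mp (hψ x) J))
      (fun y hy hyK => by simp [hr0 y hy hyK]) (stdVec i)
  have hA : IntegrableOn (fun y => sqrtDet g x y * formInner g θ (extD ψ) ((chart n x).symm y))
      (chart n x).target :=
    integrableOn_of_eq_zero_off_compact hO hK hKc
      ((contDiffOn_sqrtDet g x).mul (contDiffOn_formInner g hθ hψ.extD x)).continuousOn
      fun y hy hyK => by rw [hd0 _ (hnot y hy hyK), mul_zero]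
  have hB : IntegrableOn (fun y => sqrtDet g x y *
      innerAlt (gram g x y) (codiffRep g x θ y) (rep x ψ y)) (chart n x).target :=
    integrableOn_of_eq_zero_off_compact hO hK hKc
      ((contDiffOn_sqrtDet g x).mul (contDiffOn_innerAlt (contDiffOn_codiffRep g hθ x) (hψ x)
        (contDiffOn_gram g x) fun _ => det_gram_ne_zero g)).continuousOn
      fun y hy hyK => by rw [hr0 y hy hyK, innerAlt_zero_right, mul_zero]
  rw [← sub_eq_zero, ← integral_sub hA hB]
  rw [setIntegral_congr_fun hO.measurableSet (g := fun y => (k.factorial : ℝ)⁻¹ *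
    ∑ i : Fin n, ∑ J : Fin k → Fin n, fderiv ℝ (fun z => (raisedDensity g x θ z).curryLeft
      (stdVec i) (fun a => stdVec (J a)) * rep x ψ z (fun a => stdVec (J a))) y (stdVec i))]
  · rw [integral_const_mul, integral_finsetSum]
    · refine mul_eq_zero_of_right _ (Finset.sum_eq_zero fun i _ => ?_)
      rw [integral_finsetSum _ fun J _ => (hu i J).1]
      exact Finset.sum_eq_zero fun J _ => (hu i J).2
    · exact fun i _ => integrable_finsetSum _ fun J _ => (hu i J).1
  · intro y hy
    simp only
    rw [formInner_symm g _ _ hy, rep_extD hψ hy]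
    exact sqrtDet_mul_innerAlt_extDeriv_sub g hθ hψ hy

/-- The test form is constant in the chart, with the value of the codifferential at the given point,
and cut off near this point. -/
theorem codiffRep_eq_zero_of_forall (g : RMetric n M) {θ : DiffForm n (k + 1) M}
    (hθ : IsSmooth θ)
    (h : ∀ ψ : DiffForm n k M, IsSmooth ψ → ∫ p, formInner g θ (extD ψ) p ∂riemVolume g = 0)
    {x : M} {y : Model n} (hy : y ∈ (chart n x).target) : codiffRep g x θ y = 0 := by
  have hO := (chart n x).open_target
  set η := codiffRep g x θ y with hη
  have h0 := eq_zero_of_forall_integral_smul_eq_zero hO subset_rfl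
    (f := fun z => sqrtDet g x z * innerAlt (gram g x z) (codiffRep g x θ z) η)
    ((contDiffOn_sqrtDet g x).mul (contDiffOn_innerAlt (contDiffOn_codiffRep g hθ x)
      contDiffOn_const (contDiffOn_gram g x) fun _ => det_gram_ne_zero g)).continuousOn
    (fun χ hχ hχc hχx => by
      have h1 := h _ (isSmooth_testForm hχ hχc hχx η)
      rw [integral_formInner_extD g hθ (isSmooth_testForm hχ hχc hχx η) hχx hχc
        fun p hp => localForm_eq_zero (fun z hz => by
          rw [image_eq_zero_of_notMem_tsupport hz, zero_smul]) hp] at h1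
      rw [← h1]
      refine setIntegral_congr_fun hO.measurableSet fun z hz => ?_
      rw [rep_localForm_self _ hz, innerAlt_smul_right]
      ring) y hy
  exact eq_zero_of_innerAlt_self (posDef_gram g hy)
    ((mul_eq_zero.mp h0).resolve_left (sqrtDet_pos g hy).ne')

/-- If the codifferential, computed at each point in the chart at this point, vanishes, then its
expression in every chart vanishes. By Green's formula the expressions in two charts have the same
integrals against test forms supported in both charts, so that they correspond to each other under
the change of coordinates. -/
theorem codiffRep_eq_zero_of_codiff (g : RMetric n M) {θ : DiffForm n (k + 1) M}
    (hθ : IsSmooth θ) (h : ∀ p, codiff g θ p = 0) {x : M} {y : Model n}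
    (hy : y ∈ (chart n x).target) : codiffRep g x θ y = 0 := by
  set q := (chart n x).symm y with hq
  have hyU : y ∈ overlap n x q := mem_overlap_self hy
  have hcenter : codiffRep g q θ (chart n q q) = 0 :=
    eq_zero_of_comp_eq_zero (dChartSymm_self_comp_dChart q) (h q)
  have hO := (chart n x).open_target
  set η := codiffRep g x θ y with hη
  -- the codifferential in the chart at `q`, as a form on `M`
  set ζ : DiffForm n k M := localForm q (codiffRep g q θ) with hζ
  have hζq : ContDiffOn ℝ ∞ (rep q ζ) (chart n q).target :=
    (contDiffOn_codiffRep g hθ q).congr fun z hz => rep_localForm_self _ hz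
  have hζx : ContDiffOn ℝ ∞ (rep x ζ) (overlap n x q) :=
    (contDiffOn_comp_clm ((contDiffOn_codiffRep g hθ q).comp (contDiffOn_coordChange x q)
        fun z hz => (coordChange_mem_overlap hz).1)
        ((contDiffOn_coordChange x q).fderiv_of_isOpen (isOpen_overlap x q) (m := ∞)
          (by simp))).congr fun z hz => rep_localForm _ hz
  have hsub : overlap n x q ⊆ (chart n x).target := inter_subset_left
  have hfa : ContinuousOn (fun z => sqrtDet g x z *
      innerAlt (gram g x z) (codiffRep g x θ z) η) (overlap n x q) :=
    ((contDiffOn_sqrtDet g x).mul (contDiffOn_innerAlt (contDiffOn_codiffRep g hθ x)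
      contDiffOn_const (contDiffOn_gram g x) fun _ => det_gram_ne_zero g)).continuousOn.mono hsub
  have hfb : ContinuousOn (fun z => sqrtDet g x z * innerAlt (gram g x z) (rep x ζ z) η)
      (overlap n x q) :=
    (((contDiffOn_sqrtDet g x).mono hsub).mul (contDiffOn_innerAlt hζx contDiffOn_const
      (fun i j => (contDiffOn_gram g x i j).mono hsub)
      fun z hz => det_gram_ne_zero g (hsub hz))).continuousOn
  have h0 := eq_zero_of_forall_integral_smul_eq_zero (isOpen_overlap x q) hsub
    (f := fun z => sqrtDet g x z * innerAlt (gram g x z) (codiffRep g x θ z) η -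
      sqrtDet g x z * innerAlt (gram g x z) (rep x ζ z) η) (hfa.sub hfb)
    (fun χ hχ hχc hχU => by
      have hχx := hχU.trans hsub
      have hχ0 : ∀ z ∉ tsupport χ, χ z = 0 := fun z hz => image_eq_zero_of_notMem_tsupport hz
      set ψ : DiffForm n k M := localForm x fun z => χ z • η with hψ
      have hψs : IsSmooth ψ := isSmooth_testForm hχ hχc hχx η
      have hψ0 : ∀ p ∉ (chart n x).symm '' tsupport χ, ψ p = 0 := fun p hp =>
        localForm_eq_zero (fun z hz => by rw [hχ0 z hz, zero_smul]) hp
      have hK' : coordChange n x q '' tsupport χ ⊆ (chart n q).target := by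
        rintro _ ⟨z, hz, rfl⟩
        exact (coordChange_mem_overlap (hχU hz)).1
      have hKc' : IsCompact (coordChange n x q '' tsupport χ) :=
        hχc.isCompact.image_of_continuousOn ((contDiffOn_coordChange x q).continuousOn.mono hχU)
      have himage : (chart n q).symm '' (coordChange n x q '' tsupport χ) =
          (chart n x).symm '' tsupport χ := by
        rw [image_image]
        exact image_congr fun z hz => symm_coordChange (hχU hz)
      have g1 := integral_formInner_extD g hθ hψs hχx hχc hψ0
      have g2 := integral_formInner_extD g hθ hψs hK' hKc' (by rwa [himage])
      -- `(ζ, ψ)` is a function on `M`, so its integral may be computed in the chart at `q`, where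
      -- it is the right-hand side of `g2`, or in the chart at `x`
      have hcont : Continuous (formInner g ζ ψ) := by
        rw [continuous_iff_continuousAt]
        intro p
        by_cases hp : p ∈ (chart n x).symm '' tsupport χ
        · have hpq : p ∈ (chart n q).source := by
            obtain ⟨z, hz, rfl⟩ := hp
            exact (hχU hz).2
          exact (continuousOn_formInner g hζq (hψs q)).continuousAt
            ((chart n q).open_source.mem_nhds hpq)
        · refine (continuousAt_const (y := (0 : ℝ))).congr ?_
          filter_upwards [(isCompact_symm_image hχx hχc).isClosed.isOpen_compl.mem_nhds hp]
            with r hr using (formInner_eq_zero_of_right g ζ (hψ0 r hr)).symm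
      have hout : ∀ z, (chart n x).symm '' tsupport χ ⊆ (chart n z).source →
          ∀ p ∉ (chart n z).source, formInner g ζ ψ p = 0 := fun z hz p hp =>
        formInner_eq_zero_of_right g ζ (hψ0 p fun h => hp (hz h))
      have g3 := integral_eq_setIntegral_target g (x := q) hcont.continuousOn (hout q (by
        rintro _ ⟨z, hz, rfl⟩
        exact (hχU hz).2))
      have g4 := integral_eq_setIntegral_target g (x := x) hcont.continuousOn (hout x (by
        rintro _ ⟨z, hz, rfl⟩
        exact (chart n x).map_target (hχx hz)))
      have e1 : ∫ z in (chart n x).target,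
          χ z * (sqrtDet g x z * innerAlt (gram g x z) (codiffRep g x θ z) η) =
          ∫ p, formInner g θ (extD ψ) p ∂riemVolume g := by
        rw [g1]
        refine setIntegral_congr_fun hO.measurableSet fun z hz => ?_
        rw [hψ, rep_localForm_self _ hz, innerAlt_smul_right]
        ring
      have e2 : ∫ z in (chart n x).target,
          χ z * (sqrtDet g x z * innerAlt (gram g x z) (rep x ζ z) η) =
          ∫ p, formInner g θ (extD ψ) p ∂riemVolume g := by
        have e3 : ∫ p, formInner g θ (extD ψ) p ∂riemVolume g =
            ∫ p, formInner g ζ ψ p ∂riemVolume g := by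
          rw [g2, g3]
          refine setIntegral_congr_fun (chart n q).open_target.measurableSet fun z hz => ?_
          rw [formInner_symm g _ _ hz, hζ, rep_localForm_self _ hz]
        rw [e3, g4]
        refine setIntegral_congr_fun hO.measurableSet fun z hz => ?_
        rw [formInner_symm g _ _ hz, hψ, rep_localForm_self _ hz, innerAlt_smul_right]
        ring
      have hint : ∀ f : Model n → ℝ, ContinuousOn f (overlap n x q) →
          IntegrableOn (fun z => χ z * f z) (chart n x).target := fun f hf => by
        refine IntegrableOn.of_forall_sdiff_eq_zero (s := overlap n x q)
          (integrableOn_of_eq_zero_off_compact (isOpen_overlap x q) hχU hχc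
            (hχ.continuous.continuousOn.mul hf) fun z _ hz => by rw [hχ0 z hz, zero_mul])
          hO.measurableSet fun z hz => by rw [hχ0 z fun h => hz.2 (hχU h), zero_mul]
      simp only [mul_sub]
      rw [integral_sub (hint _ hfa) (hint _ hfb), e1, e2, sub_self]) y hyU
  have hζ0 : rep x ζ y = 0 := by
    rw [hζ, rep_localForm _ hyU]
    have : coordChange n x q y = chart n q q := rfl
    rw [this, hcenter]
    rfl
  simp only [hζ0, innerAlt_zero_left, mul_zero, sub_zero] at h0
  exact eq_zero_of_innerAlt_self (posDef_gram g hy)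
    ((mul_eq_zero.mp h0).resolve_left (sqrtDet_pos g hy).ne')

end Codifferential

/-! ### The Euler–Lagrange equation -/

section WeakFormulation

variable {n k : ℕ} {M : Type*} [TopologicalSpace M] [ChartedSpace (Model n) M]

/-- The difference of two forms of a class is exact. -/
theorem exists_extD_of_mem_smoothClass {a α η : DiffForm n (k + 1) M} (hα : α ∈ smoothClass a)
    (hη : η ∈ smoothClass a) : ∃ ψ : DiffForm n k M, IsSmooth ψ ∧ η - α = extD ψ := by
  obtain ⟨-, -, ψ, hψ, hψa⟩ := hα
  obtain ⟨-, -, φ, hφ, hφa⟩ := hη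
  refine ⟨φ - ψ, hφ.sub hψ, ?_⟩
  rw [extD_sub hφ hψ]
  have h1 : α - a = extD ψ := funext hψa
  have h2 : η - a = extD φ := funext hφa
  rw [← h1, ← h2]
  abel

variable [IsManifold (𝓡 n) ∞ M]

/-- Cutting off with a partition of unity, every smooth form is a finite sum of smooth forms with
compact supports in domains of charts. -/
theorem exists_sum_localized [T2Space M] [CompactSpace M] {ψ : DiffForm n k M} (hψ : IsSmooth ψ) :
    ∃ (t : Finset M) (ψ' : t → DiffForm n k M), (∀ i, IsSmooth (ψ' i)) ∧ ψ = ∑ i, ψ' i ∧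
      ∀ i : t, ∃ K ⊆ (chart n (i : M)).target, IsCompact K ∧
        ∀ p ∉ (chart n (i : M)).symm '' K, ψ' i p = 0 := by
  obtain ⟨t, ht⟩ := isCompact_univ.elim_finite_subcover (fun x : M => (chart n x).source)
    (fun x => (chart n x).open_source) fun p _ => mem_iUnion.mpr ⟨p, mem_chart_source _ p⟩
  obtain ⟨ρ, hρ⟩ := SmoothPartitionOfUnity.exists_isSubordinate (𝓡 n) isClosed_univ
    (fun i : t => (chart n (i : M)).source) (fun i => (chart n (i : M)).open_source)
    (fun p hp => by simpa using ht hp)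
  refine ⟨t, fun i p => ρ i p • ψ p, fun i => hψ.smul (ρ i).contMDiff, ?_, fun i => ?_⟩
  · ext1 p
    have h1 : ∑ i, ρ i p = 1 := by
      rw [← finsum_eq_sum_of_fintype]
      exact ρ.sum_eq_one (mem_univ p)
    have h2 : (∑ i, fun p => ρ i p • ψ p : DiffForm n k M) p = ∑ i, ρ i p • ψ p :=
      Finset.sum_apply p _ _
    rw [h2, ← Finset.sum_smul, h1, one_smul]
  · have hsub := hρ i
    refine ⟨chart n (i : M) '' tsupport (ρ i), ?_, ?_, fun p hp => ?_⟩
    · rintro _ ⟨p, hp, rfl⟩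
      exact (chart n (i : M)).map_source (hsub hp)
    · exact (isClosed_tsupport _).isCompact.image_of_continuousOn
        ((chart n (i : M)).continuousOn.mono hsub)
    · have : p ∉ tsupport (ρ i) := fun h =>
        hp ⟨_, mem_image_of_mem _ h, (chart n (i : M)).left_inv (hsub h)⟩
      simp only
      rw [image_eq_zero_of_notMem_tsupport this, zero_smul]

theorem add_extD_mem_smoothClass {a α : DiffForm n (k + 1) M} (hα : α ∈ smoothClass a)
    {ψ : DiffForm n k M} (hψ : IsSmooth ψ) : α + extD ψ ∈ smoothClass a := by
  obtain ⟨hs, hc, φ, hφ, hφa⟩ := hα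
  refine ⟨hs.add hψ.extD, fun p => ?_, φ + ψ, hφ.add hψ, fun p => ?_⟩
  · rw [extD_add hs hψ.extD]
    change extD α p + extD (extD ψ) p = 0
    rw [hc p, isClosedForm_extD hψ p, add_zero]
  · have h1 : α - a = extD φ := funext hφa
    rw [extD_add hφ hψ, ← h1]
    have : α + extD ψ - a = α - a + extD ψ := by abel
    rw [this]

theorem continuous_energyDensity (g : RMetric n M) {θ : DiffForm n k M} (hθ : IsSmooth θ) :
    Continuous fun p => √(1 + formInner g θ θ p) :=
  (continuous_const.add (continuous_formInner g hθ hθ)).sqrt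

theorem formInner_gmsField (g : RMetric n M) (θ η : DiffForm n k M) (p : M) :
    formInner g (gmsField g θ) η p = (√(1 + formInner g θ θ p))⁻¹ * formInner g θ η p :=
  formInner_smul_left g (fun q => (√(1 + formInner g θ θ q))⁻¹) θ η p

/-- The pointwise convexity defect of the energy density at the forms `θ` and `η`. -/
noncomputable def formDefect (g : RMetric n M) (θ η : DiffForm n k M) (p : M) : ℝ :=
  convexityDefect (gram g p (chart n p p)) (rep p θ (chart n p p)) (rep p η (chart n p p))

theorem formDefect_nonneg (g : RMetric n M) (θ η : DiffForm n k M) (p : M) :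
    0 ≤ formDefect g θ η p :=
  convexityDefect_nonneg (posDef_gram_self g p) _ _

theorem formDefect_eq (g : RMetric n M) (θ η : DiffForm n k M) (p : M) :
    formDefect g θ η p = √(1 + formInner g η η p) - √(1 + formInner g θ θ p) -
      formInner g (gmsField g θ) (η - θ) p := by
  rw [formInner_gmsField]
  rfl

theorem continuous_formDefect (g : RMetric n M) {θ η : DiffForm n k M} (hθ : IsSmooth θ)
    (hη : IsSmooth η) : Continuous (formDefect g θ η) := by
  simp only [funext (formDefect_eq g θ η)]
  exact ((continuous_energyDensity g hη).sub (continuous_energyDensity g hθ)).sub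
    (continuous_formInner g (isSmooth_gmsField g hθ) (hη.sub hθ))

variable [MeasurableSpace M] [BorelSpace M] [T2Space M] [CompactSpace M]

/-- A smooth form is coclosed if and only if it is orthogonal to the exact forms. -/
theorem codiff_eq_zero_iff (g : RMetric n M) {θ : DiffForm n (k + 1) M} (hθ : IsSmooth θ) :
    (∀ p, codiff g θ p = 0) ↔
      ∀ ψ : DiffForm n k M, IsSmooth ψ → ∫ p, formInner g θ (extD ψ) p ∂riemVolume g = 0 := by
  constructor
  · intro h ψ hψ
    obtain ⟨t, ψ', hs, hsum, hloc⟩ := exists_sum_localized hψ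
    have h1 : ∀ p, formInner g θ (extD ψ) p = ∑ i, formInner g θ (extD (ψ' i)) p := fun p => by
      rw [hsum, extD_sum _ hs, formInner_sum_right]
    simp only [h1]
    rw [integral_finsetSum _ fun i _ =>
      integrable_of_continuous g (continuous_formInner g hθ (hs i).extD)]
    refine Finset.sum_eq_zero fun i _ => ?_
    obtain ⟨K, hK, hKc, h0⟩ := hloc i
    rw [integral_formInner_extD g hθ (hs i) hK hKc h0]
    rw [setIntegral_congr_fun (g := fun _ => (0 : ℝ)) (measurableSet_target (i : M))]
    · simp
    · intro y hy
      simp only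
      rw [codiffRep_eq_zero_of_codiff g hθ h hy, innerAlt_zero_left, mul_zero]
  · intro h p
    have h1 : codiffRep g p θ (chart n p p) = 0 := codiffRep_eq_zero_of_forall g hθ h
      ((chart n p).map_source (mem_chart_source _ p))
    change (codiffRep g p θ (chart n p p)).compContinuousLinearMap (dChart p p) = 0
    rw [h1]
    rfl

theorem integral_formDefect (g : RMetric n M) {θ η : DiffForm n k M} (hθ : IsSmooth θ)
    (hη : IsSmooth η) : ∫ p, formDefect g θ η p ∂riemVolume g = energy g η - energy g θ -
      ∫ p, formInner g (gmsField g θ) (η - θ) p ∂riemVolume g := by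
  simp only [formDefect_eq]
  have h1 := integrable_of_continuous g (continuous_energyDensity g hη)
  have h2 := integrable_of_continuous g (continuous_energyDensity g hθ)
  have h3 := integrable_of_continuous g
    (continuous_formInner g (isSmooth_gmsField g hθ) (hη.sub hθ))
  have h12 : Integrable (fun p => √(1 + formInner g η η p) - √(1 + formInner g θ θ p))
    (riemVolume g) := h1.sub h2
  rw [integral_sub h12 h3, integral_sub h1 h2]
  rfl

/-- The first variation of the energy at a minimizer vanishes. -/
theorem integral_formInner_gmsField_eq_zero (g : RMetric n M) {θ w : DiffForm n k M}
    (hθ : IsSmooth θ) (hw : IsSmooth w) (h : ∀ t : ℝ, energy g θ ≤ energy g (θ + t • w)) :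
    ∫ p, formInner g (gmsField g θ) w p ∂riemVolume g = 0 := by
  set P := ∫ p, formInner g (gmsField g θ) w p ∂riemVolume g with hP
  set Q := ∫ p, formInner g w w p ∂riemVolume g with hQ
  have hle : ∀ t : ℝ, 0 ≤ t * P + t ^ 2 * Q := by
    intro t
    have i1 := integrable_of_continuous g (continuous_energyDensity g hθ)
    have i2 := integrable_of_continuous g
      (continuous_formInner g (isSmooth_gmsField g hθ) hw)
    have i3 := integrable_of_continuous g (continuous_formInner g hw hw)
    have i12 : Integrable (fun p => √(1 + formInner g θ θ p) +
        t * formInner g (gmsField g θ) w p) (riemVolume g) := i1.add (i2.const_mul t)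
    have h1 : energy g (θ + t • w) ≤ energy g θ + t * P + t ^ 2 * Q := by
      rw [energy, energy, hP, hQ, ← integral_const_mul, ← integral_const_mul,
        ← integral_add i1 (i2.const_mul t), ← integral_add i12 (i3.const_mul _)]
      refine integral_mono (integrable_of_continuous g
        (continuous_energyDensity g (hθ.add (hw.const_smul t))))
        (i12.add (i3.const_mul _)) fun p => ?_
      have h2 := sqrt_innerAlt_add_smul_le (posDef_gram_self g p) (rep p θ (chart n p p))
        (rep p w (chart n p p)) t
      simp only
      rw [formInner_gmsField]
      exact h2
    linarith [h t]
  by_contra hP0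
  have hQ0 : 0 ≤ Q := integral_nonneg fun p => formInner_self_nonneg g w p
  -- the value at `t = -P / (1 + Q)` is negative
  have h2 := hle (-P / (1 + Q))
  have h3 : -P / (1 + Q) * P + (-P / (1 + Q)) ^ 2 * Q = -(P ^ 2 / (1 + Q) ^ 2) := by
    field_simp
    ring
  rw [h3] at h2
  have h4 : 0 < P ^ 2 / (1 + Q) ^ 2 := by positivity
  linarith

/-- For a minimizer `α` the form `α / √(1 + |α|²)` is orthogonal to the differences of `α` and its
competitors. In degree `0` the class has only one element. -/
theorem integral_formInner_sub_eq_zero (g : RMetric n M) {a α : DiffForm n k M}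
    (hα : IsSmoothMinimizer g a α) {η : DiffForm n k M} (hη : η ∈ smoothClass a) :
    ∫ p, formInner g (gmsField g α) (η - α) p ∂riemVolume g = 0 := by
  obtain ⟨hαa, hmin⟩ := hα
  cases k with
  | zero =>
    have h0 : ∀ p, (η - α) p = 0 := fun p => by
      have h1 := hαa.2.2 p
      have h2 := hη.2.2 p
      change η p - α p = 0
      rw [sub_eq_zero.mp h1, sub_eq_zero.mp h2, sub_self]
    simp [formInner_eq_zero_of_right g (gmsField g α) (h0 _)]
  | succ k =>
    obtain ⟨ψ, hψ, hd⟩ := exists_extD_of_mem_smoothClass hαa hη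
    rw [hd]
    refine integral_formInner_gmsField_eq_zero g hαa.1 hψ.extD fun t => hmin _ ?_
    rw [← extD_smul]
    exact add_extD_mem_smoothClass hαa (hψ.const_smul t)

/-- The Euler–Lagrange equation characterizes the minimizers. -/
theorem isSmoothMinimizer_iff (g : RMetric n M) {a α : DiffForm n k M} (hα : α ∈ smoothClass a) :
    IsSmoothMinimizer g a α ↔ ∀ p, codiff g (gmsField g α) p = 0 := by
  cases k with
  | zero =>
    refine ⟨fun _ _ => rfl, fun _ => ⟨hα, fun η hη => le_of_eq ?_⟩⟩
    have h0 : α = η := funext fun p => by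
      rw [sub_eq_zero.mp (hα.2.2 p), sub_eq_zero.mp (hη.2.2 p)]
    rw [h0]
  | succ k =>
    have hs := isSmooth_gmsField g hα.1
    rw [codiff_eq_zero_iff g hs]
    constructor
    · intro h ψ hψ
      have h1 := integral_formInner_sub_eq_zero g h (add_extD_mem_smoothClass hα hψ)
      rwa [add_sub_cancel_left] at h1
    · intro h
      refine ⟨hα, fun η hη => ?_⟩
      obtain ⟨ψ, hψ, hd⟩ := exists_extD_of_mem_smoothClass hα hη
      have h1 := integral_formDefect g hα.1 hη.1
      rw [hd, h ψ hψ, sub_zero] at h1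
      have h2 : 0 ≤ ∫ p, formDefect g α η p ∂riemVolume g :=
        integral_nonneg fun p => formDefect_nonneg g α η p
      linarith

end WeakFormulation

/-! ### Sobolev forms and the relaxed energy -/

section SobolevForms

variable {n k : ℕ}

theorem hasWeakDerivOn_of_contDiffOn {F : Type*} [NormedAddCommGroup F] [NormedSpace ℝ F]
    {Ω : Set (Model n)} (hΩ : IsOpen Ω) {u : Model n → F} (hu : ContDiffOn ℝ ∞ u Ω) :
    HasWeakDerivOn Ω u (fderiv ℝ u) := by
  have hdu : ContinuousOn (fderiv ℝ u) Ω := hu.continuousOn_fderiv_of_isOpen hΩ (by simp)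
  refine ⟨hu.continuousOn.locallyIntegrableOn hΩ.measurableSet,
    hdu.locallyIntegrableOn hΩ.measurableSet, fun φ hφ hφc hφΩ v => ?_⟩
  have hφ0 : ∀ y ∉ tsupport φ, φ y = 0 := fun y hy => image_eq_zero_of_notMem_tsupport hy
  have hφ0' : ∀ y ∉ tsupport φ, fderiv ℝ φ y = 0 := fun y hy =>
    image_eq_zero_of_notMem_tsupport fun h => hy (tsupport_fderiv_subset ℝ h)
  have h1 := setIntegral_fderiv_eq_zero hΩ hφΩ hφc (u := fun y => φ y • u y)
    (hφ.contDiffOn.smul hu) (fun y _ hy => by rw [hφ0 y hy, zero_smul]) v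
  have h2 : ∀ y ∈ Ω, fderiv ℝ (fun y => φ y • u y) y v =
      fderiv ℝ φ y v • u y + φ y • fderiv ℝ u y v := fun y hy => by
    rw [fderiv_fun_smul (hφ.differentiable (by simp) y)
      ((hu.contDiffAt (hΩ.mem_nhds hy)).differentiableAt (by simp))]
    simp [add_comm]
  have i1 : IntegrableOn (fun y => fderiv ℝ φ y v • u y) Ω :=
    integrableOn_of_eq_zero_off_compact hΩ hφΩ hφc
      (((hφ.continuous_fderiv (by simp)).clm_apply continuous_const).continuousOn.smul
        hu.continuousOn) fun y _ hy => by rw [hφ0' y hy]; simp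
  have i2 : IntegrableOn (fun y => φ y • fderiv ℝ u y v) Ω :=
    integrableOn_of_eq_zero_off_compact hΩ hφΩ hφc
      (hφ.continuous.continuousOn.smul (hdu.clm_apply continuousOn_const))
      fun y _ hy => by rw [hφ0 y hy, zero_smul]
  have h3 := h1.2
  rw [setIntegral_congr_fun hΩ.measurableSet h2, integral_add i1 i2] at h3
  exact eq_neg_of_add_eq_zero_left h3

theorem memLp_of_continuousOn_compact {F : Type*} [NormedAddCommGroup F] {K : Set (Model n)}
    (hK : IsCompact K) {f : Model n → F} (hf : ContinuousOn f K) :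
    MemLp f 2 (volume.restrict K) := by
  have : IsFiniteMeasure (volume.restrict K) := ⟨by simpa using hK.measure_lt_top⟩
  obtain ⟨C, hC⟩ := hK.exists_bound_of_continuousOn hf
  exact MemLp.of_bound (hf.aestronglyMeasurable_of_isCompact hK hK.measurableSet) C
    ((ae_restrict_iff' hK.measurableSet).mpr (Eventually.of_forall hC))

variable {M : Type*} [TopologicalSpace M] [ChartedSpace (Model n) M]

theorem IsSmooth.hasWeakDerivOn {θ : DiffForm n k M} (hθ : IsSmooth θ) (x : M) :
    HasWeakDerivOn (chart n x).target (rep x θ) (fderiv ℝ (rep x θ)) :=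
  hasWeakDerivOn_of_contDiffOn (chart n x).open_target (hθ x)

theorem IsSmooth.isW12 {θ : DiffForm n k M} (hθ : IsSmooth θ) : IsW12 θ := fun x =>
  ⟨_, hθ.hasWeakDerivOn x, fun _ hK hKc =>
    ⟨memLp_of_continuousOn_compact hKc ((hθ x).continuousOn.mono hK),
      memLp_of_continuousOn_compact hKc
        (((hθ x).continuousOn_fderiv_of_isOpen (chart n x).open_target (by simp)).mono hK)⟩⟩

theorem tendsto_eLpNorm_sub_self {F : Type*} [NormedAddCommGroup F] (f : Model n → F)
    (μ : Measure (Model n)) :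
    Tendsto (fun _ : ℕ => eLpNorm (fun y => f y - f y) 2 μ) atTop (𝓝 0) := by
  simp

theorem tendstoW12_const {θ : DiffForm n k M} (hθ : IsSmooth θ) :
    TendstoW12 (fun _ => θ) θ := fun x =>
  ⟨_, hθ.hasWeakDerivOn x, fun _ _ _ => ⟨tendsto_eLpNorm_sub_self (rep x θ) _,
    tendsto_eLpNorm_sub_self (fderiv ℝ (rep x θ)) _⟩⟩

variable [IsManifold (𝓡 n) ∞ M]

theorem mem_w12Class_of_mem_smoothClass {a α : DiffForm n k M} (hα : α ∈ smoothClass a) :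
    α ∈ w12Class a := by
  refine ⟨hα.1.isW12, ?_⟩
  cases k with
  | zero =>
    refine fun x => Eventually.of_forall fun y => ?_
    have h : (α - a) ((chart n x).symm y) = 0 := hα.2.2 _
    rw [rep, h]
    rfl
  | succ k =>
    obtain ⟨hs, -, ψ, hψ, hd⟩ := hα
    refine ⟨ψ, hψ.isW12, fun x => ⟨_, hψ.hasWeakDerivOn x, ?_⟩⟩
    refine (ae_restrict_iff' (measurableSet_target x)).mpr (Eventually.of_forall fun y hy => ?_)
    have h : α - a = extD ψ := funext hd
    rw [h]
    exact rep_extD hψ hy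

theorem formDefect_symm (g : RMetric n M) (θ η : DiffForm n k M) {x : M} {y : Model n}
    (hy : y ∈ (chart n x).target) : formDefect g θ η ((chart n x).symm y) =
      convexityDefect (gram g x y) (rep x θ y) (rep x η y) := by
  rw [formDefect_eq, formInner_gmsField, formInner_symm g _ _ hy, formInner_symm g _ _ hy,
    formInner_symm g _ _ hy]
  rfl

variable [MeasurableSpace M]

theorem relaxedEnergy_le (g : RMetric n M) {a α : DiffForm n k M} (hα : α ∈ smoothClass a) :
    relaxedEnergy g a α ≤ (energy g α : EReal) := by
  unfold relaxedEnergy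
  refine iInf_le_of_le ⟨fun _ => α, fun _ => hα, tendstoW12_const hα.1⟩ ?_
  exact (liminf_const (f := (atTop : Filter ℕ)) ((energy g α : ℝ) : EReal)).le

theorem le_relaxedEnergy (g : RMetric n M) {a α : DiffForm n k M} (hα : IsSmoothMinimizer g a α)
    (β : DiffForm n k M) : (energy g α : EReal) ≤ relaxedEnergy g a β :=
  le_iInf fun s => le_liminf_of_le (by isBoundedDefault)
    (Eventually.of_forall fun m => EReal.coe_le_coe (hα.2 _ (s.2.1 m)))

/-- A minimizer in the smooth class minimizes the relaxed energy, whose values are limits of values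
of the energy on the smooth class. -/
theorem IsSmoothMinimizer.isW12Minimizer (g : RMetric n M) {a α : DiffForm n k M}
    (hα : IsSmoothMinimizer g a α) : IsW12Minimizer g a α :=
  ⟨mem_w12Class_of_mem_smoothClass hα.1, fun η _ =>
    (relaxedEnergy_le g hα.1).trans (le_relaxedEnergy g hα η)⟩

theorem continuous_innerAlt_self (G : Matrix (Fin n) (Fin n) ℝ) :
    Continuous fun v : Model n [⋀^Fin k]→L[ℝ] ℝ => innerAlt G v v := by
  have h : ∀ I : Fin k → Fin n,
      Continuous fun v : Model n [⋀^Fin k]→L[ℝ] ℝ => v fun a => stdVec (I a) := fun I =>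
    (ContinuousAlternatingMap.apply ℝ (Model n) ℝ fun a => stdVec (I a)).continuous
  unfold innerAlt
  exact continuous_const.mul (continuous_finsetSum _ fun I _ => continuous_finsetSum _ fun J _ =>
    (continuous_const.mul (h I)).mul (h J))

theorem continuous_innerAlt_right (G : Matrix (Fin n) (Fin n) ℝ) (u : Model n [⋀^Fin k]→L[ℝ] ℝ) :
    Continuous fun v : Model n [⋀^Fin k]→L[ℝ] ℝ => innerAlt G u v := by
  have h : ∀ I : Fin k → Fin n,
      Continuous fun v : Model n [⋀^Fin k]→L[ℝ] ℝ => v fun a => stdVec (I a) := fun I =>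
    (ContinuousAlternatingMap.apply ℝ (Model n) ℝ fun a => stdVec (I a)).continuous
  unfold innerAlt
  exact continuous_const.mul (continuous_finsetSum _ fun I _ => continuous_finsetSum _ fun J _ =>
    continuous_const.mul (h J))

theorem continuous_convexityDefect (G : Matrix (Fin n) (Fin n) ℝ)
    (u : Model n [⋀^Fin k]→L[ℝ] ℝ) : Continuous (convexityDefect G u) := by
  unfold convexityDefect
  exact (((continuous_const.add (continuous_innerAlt_self G)).sqrt).sub continuous_const).sub
    (continuous_const.mul ((continuous_innerAlt_right G u).comp
      (continuous_id.sub continuous_const)))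

/-- A subsequence realizes the bound on the lower limit for each of its terms. -/
theorem exists_seq_energy_lt (g : RMetric n M) {a β : DiffForm n k M} {E : ℝ}
    (h : relaxedEnergy g a β < (E : EReal)) :
    ∃ s : ℕ → DiffForm n k M, (∀ m, s m ∈ smoothClass a) ∧ TendstoW12 s β ∧
      ∀ m, energy g (s m) < E := by
  obtain ⟨⟨s, hs, hsβ⟩, hlt⟩ := iInf_lt_iff.mp h
  obtain ⟨j, hj, hjE⟩ := extraction_of_frequently_atTop
    (frequently_lt_of_liminf_lt (by isBoundedDefault) hlt)
  refine ⟨s ∘ j, fun m => hs _, fun x => ?_, fun m => EReal.coe_lt_coe_iff.mp (hjE m)⟩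
  obtain ⟨D, hD, hconv⟩ := hsβ x
  exact ⟨D, hD, fun K hK hKc => ⟨(hconv K hK hKc).1.comp hj.tendsto_atTop,
    (hconv K hK hKc).2.comp hj.tendsto_atTop⟩⟩

variable [BorelSpace M] [T2Space M] [CompactSpace M]

/-- The part over a chart of the integral of the convexity defect at a competitor is bounded by the
excess of energy of the competitor. -/
theorem lintegral_convexityDefect_le (g : RMetric n M) {a α η : DiffForm n k M}
    (hα : IsSmoothMinimizer g a α) (hη : η ∈ smoothClass a) {x : M} {K : Set (Model n)}
    (hK : K ⊆ (chart n x).target) (hKm : MeasurableSet K) :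
    ∫⁻ y in K, volumeDensity g x y *
        ENNReal.ofReal (convexityDefect (gram g x y) (rep x α y) (rep x η y)) ≤
      ENNReal.ofReal (energy g η - energy g α) := by
  have hcont := continuous_formDefect g hα.1.1 hη.1
  calc _ = ∫⁻ y in K, volumeDensity g x y *
        ENNReal.ofReal (formDefect g α η ((chart n x).symm y)) :=
        setLIntegral_congr_fun hKm fun y hy => by
          rw [formDefect_symm g α η (hK hy)]
    _ ≤ ∫⁻ y in (chart n x).target, volumeDensity g x y *
        ENNReal.ofReal (formDefect g α η ((chart n x).symm y)) := lintegral_mono_set hK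
    _ = ∫⁻ p, ENNReal.ofReal (formDefect g α η p) ∂chartVolume g x :=
        (lintegral_chartVolume g x hcont.measurable.ennreal_ofReal).symm
    _ ≤ ∫⁻ p, ENNReal.ofReal (formDefect g α η p) ∂riemVolume g :=
        lintegral_mono' (chartVolume_le g x) le_rfl
    _ = ENNReal.ofReal (∫ p, formDefect g α η p ∂riemVolume g) :=
        (ofReal_integral_eq_lintegral_ofReal (integrable_of_continuous g hcont)
          (Eventually.of_forall (formDefect_nonneg g α η))).symm
    _ = ENNReal.ofReal (energy g η - energy g α) := by
        rw [integral_formDefect g hα.1.1 hη.1, integral_formInner_sub_eq_zero g hα hη, sub_zero]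

/-- By Fatou's lemma the bound for the convexity defect passes to the limit in `W^{1,2}`. -/
theorem lintegral_convexityDefect_le_of_tendsto (g : RMetric n M) {a α β : DiffForm n k M}
    (hα : IsSmoothMinimizer g a α) {s : ℕ → DiffForm n k M} (hs : ∀ m, s m ∈ smoothClass a)
    (hsβ : TendstoW12 s β) {C : ℝ} (hC : ∀ m, energy g (s m) - energy g α ≤ C) {x : M}
    {K : Set (Model n)} (hK : K ⊆ (chart n x).target) (hKc : IsCompact K) :
    AEMeasurable (fun y => volumeDensity g x y *
      ENNReal.ofReal (convexityDefect (gram g x y) (rep x α y) (rep x β y))) (volume.restrict K) ∧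
    ∫⁻ y in K, volumeDensity g x y *
        ENNReal.ofReal (convexityDefect (gram g x y) (rep x α y) (rep x β y)) ≤
      ENNReal.ofReal C := by
  obtain ⟨D, hD, hconv⟩ := hsβ x
  have hβ : AEStronglyMeasurable (rep x β) (volume.restrict K) :=
    (hD.locInt.integrableOn_compact_subset hK hKc).aestronglyMeasurable
  have hsm : ∀ m, AEStronglyMeasurable (rep x (s m)) (volume.restrict K) := fun m =>
    (((hs m).1 x).continuousOn.mono hK).aestronglyMeasurable_of_isCompact hKc hKc.measurableSet
  obtain ⟨j, -, hj⟩ := (tendstoInMeasure_of_tendsto_eLpNorm two_ne_zero hsm hβ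
    (hconv K hK hKc).1).exists_seq_tendsto_ae
  have hmeas : ∀ m, AEMeasurable (fun y => volumeDensity g x y *
      ENNReal.ofReal (convexityDefect (gram g x y) (rep x α y) (rep x (s m) y)))
      (volume.restrict K) := fun m => by
    refine ((aemeasurable_volumeDensity g x).mono_measure (Measure.restrict_mono hK le_rfl)).mul ?_
    have hc : ContinuousOn (fun y => formDefect g α (s m) ((chart n x).symm y)) K :=
      (continuous_formDefect g hα.1.1 (hs m).1).comp_continuousOn
        ((chart n x).continuousOn_symm.mono hK)
    refine (AEMeasurable.ennreal_ofReal ?_)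
    exact (hc.congr fun y hy => (formDefect_symm g α (s m) (hK hy)).symm).aemeasurable
      hKc.measurableSet
  have hlim : ∀ᵐ y ∂volume.restrict K, Tendsto (fun i => volumeDensity g x y *
      ENNReal.ofReal (convexityDefect (gram g x y) (rep x α y) (rep x (s (j i)) y))) atTop
      (𝓝 (volumeDensity g x y *
        ENNReal.ofReal (convexityDefect (gram g x y) (rep x α y) (rep x β y)))) := by
    filter_upwards [hj] with y hy
    refine ENNReal.Tendsto.const_mul (ENNReal.tendsto_ofReal ?_) (Or.inr ENNReal.ofReal_ne_top)
    exact ((continuous_convexityDefect (gram g x y) (rep x α y)).tendsto _).comp hy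
  refine ⟨aemeasurable_of_tendsto_metrizable_ae atTop (fun i => hmeas (j i)) hlim, ?_⟩
  calc _ = ∫⁻ y in K, liminf (fun i => volumeDensity g x y *
      ENNReal.ofReal (convexityDefect (gram g x y) (rep x α y) (rep x (s (j i)) y))) atTop :=
        lintegral_congr_ae (hlim.mono fun y hy => hy.liminf_eq.symm)
    _ ≤ liminf (fun i => ∫⁻ y in K, volumeDensity g x y *
      ENNReal.ofReal (convexityDefect (gram g x y) (rep x α y) (rep x (s (j i)) y))) atTop :=
        lintegral_liminf_le' fun i => hmeas (j i)
    _ ≤ ENNReal.ofReal C := by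
        refine liminf_le_of_le (by isBoundedDefault) fun b hb => ?_
        obtain ⟨i, hi⟩ := hb.exists
        exact hi.trans ((lintegral_convexityDefect_le g hα (hs (j i)) hK hKc.measurableSet).trans
          (ENNReal.ofReal_le_ofReal (hC (j i))))

/-- Uniqueness: approximations of `β` with energies close to the minimum have small convexity
defects relative to `α`, so that the convexity defect of `α` and `β` is zero. -/
theorem ae_eq_of_isW12Minimizer (g : RMetric n M) {a α β : DiffForm n k M}
    (hα : IsSmoothMinimizer g a α) (hβ : IsW12Minimizer g a β) :
    ∀ᵐ p ∂riemVolume g, β p = α p := by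
  have hle : relaxedEnergy g a β ≤ (energy g α : EReal) :=
    (hβ.2 α (mem_w12Class_of_mem_smoothClass hα.1)).trans (relaxedEnergy_le g hα.1)
  have hcompact : ∀ (x : M) (K : Set (Model n)), K ⊆ (chart n x).target → IsCompact K →
      ∀ᵐ y ∂volume.restrict K, rep x β y = rep x α y := by
    intro x K hK hKc
    have hbound : ∀ C : ℝ, 0 < C → AEMeasurable (fun y => volumeDensity g x y *
        ENNReal.ofReal (convexityDefect (gram g x y) (rep x α y) (rep x β y)))
          (volume.restrict K) ∧
        ∫⁻ y in K, volumeDensity g x y *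
          ENNReal.ofReal (convexityDefect (gram g x y) (rep x α y) (rep x β y)) ≤
            ENNReal.ofReal C := fun C hC => by
      obtain ⟨s, hs, hsβ, hE⟩ := exists_seq_energy_lt g (β := β) (E := energy g α + C)
        (hle.trans_lt (EReal.coe_lt_coe (by linarith)))
      exact lintegral_convexityDefect_le_of_tendsto g hα hs hsβ (C := C)
        (fun m => by linarith [hE m]) hK hKc
    have hzero : ∫⁻ y in K, volumeDensity g x y *
        ENNReal.ofReal (convexityDefect (gram g x y) (rep x α y) (rep x β y)) = 0 := by
      refine le_antisymm (ENNReal.le_of_forall_pos_le_add fun ε hε _ => ?_) zero_le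
      rw [zero_add]
      simpa using (hbound ε hε).2
    rw [lintegral_eq_zero_iff' (hbound 1 one_pos).1] at hzero
    filter_upwards [hzero, self_mem_ae_restrict hKc.measurableSet] with y hy hyK
    have hyT := hK hyK
    have h1 : ENNReal.ofReal (convexityDefect (gram g x y) (rep x α y) (rep x β y)) = 0 :=
      (mul_eq_zero.mp hy).resolve_left (ENNReal.ofReal_pos.mpr (sqrtDet_pos g hyT)).ne'
    exact eq_of_convexityDefect_eq_zero (posDef_gram g hyT)
      (le_antisymm (ENNReal.ofReal_eq_zero.mp h1) (convexityDefect_nonneg (posDef_gram g hyT) _ _))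
  refine ae_riemVolume g fun x => ?_
  have hrep : ∀ᵐ y ∂volume.restrict (chart n x).target, rep x β y = rep x α y := by
    rw [ae_restrict_iff' (measurableSet_target x)]
    refine measure_null_of_locally_null _ fun y hy => ?_
    have hyT : y ∈ (chart n x).target := by
      by_contra h
      exact hy fun h' => absurd h' h
    obtain ⟨r, hr, hball⟩ := Metric.nhds_basis_closedBall.mem_iff.mp
      ((chart n x).open_target.mem_nhds hyT)
    have h1 := hcompact x _ hball (isCompact_closedBall _ _)
    rw [ae_restrict_iff' (isCompact_closedBall y r).measurableSet] at h1
    refine ⟨_, inter_mem_nhdsWithin _ (Metric.closedBall_mem_nhds y hr),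
      measure_mono_null (fun z hz => ?_) h1⟩
    intro h2
    exact hz.1 fun _ => h2 hz.2
  filter_upwards [hrep, self_mem_ae_restrict (measurableSet_target x)] with y hy hyT
  have h0 : ((β ((chart n x).symm y) - α ((chart n x).symm y) :
      Model n [⋀^Fin k]→L[ℝ] ℝ)).compContinuousLinearMap (dChartSymm x y) = 0 :=
    sub_eq_zero.mpr hy
  exact sub_eq_zero.mp (eq_zero_of_comp_eq_zero (dChart_comp_dChartSymm_self hyT) h0)

end SobolevForms

end GMS

theorem mainTheorem9 {n : ℕ} {M : Type*} [TopologicalSpace M] [T2Space M] [CompactSpace M]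
    [ChartedSpace (GMS.Model n) M] [IsManifold (𝓡 n) ∞ M] [MeasurableSpace M] [BorelSpace M]
    (g : GMS.RMetric n M) {k : ℕ} (a : GMS.DiffForm n k M)
    (ha : GMS.IsSmooth a) (ha' : GMS.IsClosedForm a)
    (α : GMS.DiffForm n k M) (hα : α ∈ GMS.smoothClass a) :
    (GMS.IsSmoothMinimizer g a α ↔ ∀ p, GMS.codiff g (GMS.gmsField g α) p = 0) ∧
    (GMS.IsSmoothMinimizer g a α →
      GMS.IsW12Minimizer g a α ∧
      ∀ β, GMS.IsW12Minimizer g a β → ∀ᵐ p ∂(GMS.riemVolume g), β p = α p) :=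
  ⟨GMS.isSmoothMinimizer_iff g hα, fun h =>
    ⟨h.isW12Minimizer, fun _ hβ => GMS.ae_eq_of_isW12Minimizer g h hβ⟩⟩
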